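/- **Conventions.** For a permutation $\pi=\pi_1\cdots\pi_n\in\mathfrak S_n$ ($n\ge 0$) let $\mathrm{Des}(\pi)=\{i\in[n-1]:\pi_i>\pi_{i+1}\}$, $\mathrm{des}(\pi)=|\mathrm{Des}(\pi)|$, $\mathrm{comaj}(\pi)=\sum_{i\in\mathrm{Des}(\pi)}(n-i)$, let $\mathrm{pk}(\pi)$ be the number of peaks, i.e. of $i\in\{2,\dots,n-1\}$ with $\pi_{i-1}<\pi_i>\pi_{i+1}$, and let $\mathrm{lpk}(\pi)$ be the number of left peaks, i.e. of $i\in[n-1]$ such that $i$ is a peak, or $i=1$ and $1\in\mathrm{Des}(\pi)$. For a statistic $\mathrm{st}$ put $\mathrm{ist}(\pi)=\mathrm{st}(\pi^{-1})$. $\mathrm{Comp}(\pi)$ is the composition of $n$ whose parts are the lengths of the maximal increasing runs of $\pi$, in order. The above statistics depend only on $\mathrm{Comp}(\pi)$, and $\mathrm{st}(L)$ denotes the value of $\mathrm{st}$ on any $\pi$ with $\mathrm{Comp}(\pi)=L$. Compositions $L,K$ are $\mathrm{st}$-equivalent if $|L|=|K|$ and $\mathrm{st}(L)=\mathrm{st}(K)$.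 The standardization $\mathrm{std}(w)$ of a word $w$ of positive integers is obtained by replacing its letters by their ranks, equal letters being ranked from left to right. In the algebra $\mathbb Q\langle\langle A^*\rangle\rangle$ of formal sums of words in noncommuting variables $A=\{X_1,X_2,\dots\}$, let $\mathbf G_\pi=\sum_{\mathrm{std}(i_1\cdots i_n)=\pi}X_{i_1}\cdots X_{i_n}$; these are linearly independent and span the subalgebra $\mathbf{FQSym}$. $\mathrm{QSym}$ is the $\mathbb Q$-algebra of quasisymmetric functions in commuting variables $x_1,x_2,\dots$, with fundamental basis $F_L=\sum x_{i_1}\cdots x_{i_n}$ over all $i_1\le\cdots\le i_n$ with $i_j<i_{j+1}$ whenever $j\in\{L_1,L_1+L_2,\dots,L_1+\cdots+L_{k-1}\}$, for $L=(L_1,\dots,L_k)$ a composition of $n$. Let $\rho:\mathbf{FQSym}\to\mathrm{QSym}$ be the linear map with $\rho(\mathbf G_\pi)=F_{\mathrm{Comp}(\pi^{-1})}$. $\mathbb Q[[t*,x]]$ and $\mathbb Q[[t*,q,x]]$ denote the $\mathbb Q$-algebras of formal power series in which multiplication is the Hadamard product in $t$, $(\sum_k a_kt^k)*(\sum_k b_kt^k)=\sum_k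 a_kb_kt^k$, and is ordinary in $x$ and $q$; their identity is $1/(1-t)$. In the formulas below all products and quotients are the ordinary ones. **Theorem.** Define linear maps on $\mathbf{FQSym}$ by, for $\pi\in\mathfrak S_n$, $$\Psi_{(\mathrm{ides},\mathrm{icomaj})}(\mathbf G_\pi)=\begin{cases}\dfrac{t^{\mathrm{ides}(\pi)+1}q^{\mathrm{icomaj}(\pi)}}{\prod_{i=0}^n(1-tq^i)}x^n,&n\ge1,\\[1ex] 1/(1-t),&n=0,\end{cases}$$ $$\Psi_{\mathrm{ipk}}(\mathbf G_\pi)=\begin{cases}\dfrac{2^{2\mathrm{ipk}(\pi)+1}t^{\mathrm{ipk}(\pi)+1}(1+t)^{n-2\mathrm{ipk}(\pi)-1}}{(1-t)^{n+1}}x^n,&n\ge1,\\[1ex] 1/(1-t),&n=0,\end{cases}$$ $$\Psi_{\mathrm{ilpk}}(\mathbf G_\pi)=\frac{2^{2\mathrm{ilpk}(\pi)}t^{\mathrm{ilpk}(\pi)}(1+t)^{n-2\mathrm{ilpk}(\pi)}}{(1-t)^{n+1}}x^n .$$ Then $\Psi_{(\mathrm{ides},\mathrm{icomaj})}:\mathbf{FQSym}\to\mathbb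 Q[[t*,q,x]]$, $\Psi_{\mathrm{ipk}}:\mathbf{FQSym}\to\mathbb Q[[t*,x]]$ and $\Psi_{\mathrm{ilpk}}:\mathbf{FQSym}\to\mathbb Q[[t*,x]]$ are $\mathbb Q$-algebra homomorphisms. Moreover, $\rho$ is a surjective $\mathbb Q$-algebra homomorphism, and for $\mathrm{st}=(\mathrm{des},\mathrm{comaj}),\mathrm{pk},\mathrm{lpk}$ there is a $\mathbb Q$-algebra homomorphism $\phi_{\mathrm{st}}$ from $\mathrm{QSym}$ to the respective power series algebra with $\Psi_{\mathrm{ist}}=\phi_{\mathrm{st}}\circ\rho$ (where $\mathrm{ist}=(\mathrm{ides},\mathrm{icomaj}),\mathrm{ipk},\mathrm{ilpk}$), for which $\phi_{\mathrm{st}}(F_L)$, $|L|=n$, is given by the same formula with the values of $\mathrm{st}(L)$ in place of those of $\mathrm{ist}(\pi)$, and which maps onto a shuffle algebra of $\mathrm{st}$: the image $\mathcal A_{\mathrm{st}}$ of $\phi_{\mathrm{st}}$ has a basis $(u_\alpha)$ indexed by the $\mathrm{st}$-equivalence classes $\alpha$ of compositions such that $\phi_{\mathrm{st}}(F_L)=u_\alpha$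 whenever $L\in\alpha$. -/

import Mathlib

open Finset

noncomputable section

namespace FreeQSym

/-! ### The total algebra of words -/

/-- `ℚ⟨⟨A*⟩⟩`: formal (possibly infinite) rational combinations of words in the noncommuting
variables `A = {X₀, X₁, X₂, …}`, a word `X_{i₁} ⋯ X_{iₙ}` being the list `[i₁, …, iₙ]`. An element
is given by its coefficients. -/
def TotalAlgebra : Type := List ℕ → ℚ

namespace TotalAlgebra

instance : AddCommGroup TotalAlgebra := inferInstanceAs (AddCommGroup (List ℕ → ℚ))
instance : Module ℚ TotalAlgebra := inferInstanceAs (Module ℚ (List ℕ → ℚ))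

@[ext] theorem ext {f g : TotalAlgebra} (h : ∀ w, f w = g w) : f = g := funext h

/-- The empty word. -/
instance : One TotalAlgebra := ⟨fun w => if w = [] then 1 else 0⟩

/-- The product extends concatenation of words: the coefficient of `w` in `f * g` is the sum of
`f u * g v` over all factorizations `w = u ++ v`. -/
instance : Mul TotalAlgebra :=
  ⟨fun f g w => ∑ i ∈ range (w.length + 1), f (w.take i) * g (w.drop i)⟩

theorem one_apply (w : List ℕ) : (1 : TotalAlgebra) w = if w = [] then 1 else 0 := rfl
theorem mul_apply (f g : TotalAlgebra) (w : List ℕ) :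
    (f * g) w = ∑ i ∈ range (w.length + 1), f (w.take i) * g (w.drop i) := rfl
theorem add_apply (f g : TotalAlgebra) (w : List ℕ) : (f + g) w = f w + g w := rfl
theorem zero_apply (w : List ℕ) : (0 : TotalAlgebra) w = 0 := rfl
theorem smul_apply (c : ℚ) (f : TotalAlgebra) (w : List ℕ) : (c • f) w = c * f w := rfl

protected theorem mul_assoc (f g h : TotalAlgebra) : f * g * h = f * (g * h) := by
  ext w
  simp only [mul_apply, sum_mul, mul_sum]
  rw [sum_sigma', sum_sigma']
  refine sum_nbij' (fun p => ⟨p.2, p.1 - p.2⟩) (fun p => ⟨p.1 + p.2, p.1⟩) ?_ ?_ ?_ ?_ ?_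
  · rintro ⟨i, j⟩ h
    simp at h ⊢
    omega
  · rintro ⟨i, j⟩ h
    simp at h ⊢
    omega
  · rintro ⟨i, j⟩ h
    simp at h ⊢
    omega
  · rintro ⟨i, j⟩ h
    simp
  · rintro ⟨i, j⟩ h
    simp at h ⊢
    have : min j i = j := by omega
    have h' : j + (i - j) = i := by omega
    rw [List.take_take, this, List.drop_take, mul_assoc, h']

instance : Ring TotalAlgebra :=
  { (inferInstance : AddCommGroup TotalAlgebra),
    (inferInstance : One TotalAlgebra), (inferInstance : Mul TotalAlgebra) with
    mul_assoc := TotalAlgebra.mul_assoc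
    left_distrib := fun f g h => by
      ext w; simp [mul_apply, add_apply, mul_add, sum_add_distrib]
    right_distrib := fun f g h => by
      ext w; simp [mul_apply, add_apply, add_mul, sum_add_distrib]
    zero_mul := fun f => by ext w; simp [mul_apply, zero_apply]
    mul_zero := fun f => by ext w; simp [mul_apply, zero_apply]
    one_mul := fun f => by
      ext w
      rw [mul_apply, sum_eq_single 0]
      · simp [one_apply]
      · intro i hi h0
        have : w.take i ≠ [] := by
          intro h; simp at h hi; rcases h with h | h
          · exact h0 h
          · subst h; simp at hi; omega
        simp [one_apply, this]
      · simp
    mul_one := fun f => by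
      ext w
      rw [mul_apply, sum_eq_single w.length]
      · simp [one_apply]
      · intro i hi h0
        have : w.drop i ≠ [] := by
          intro h; simp at h hi; omega
        simp [one_apply, this]
      · simp }

instance : Algebra ℚ TotalAlgebra := Algebra.ofModule
  (fun c f g => by ext w; simp [mul_apply, smul_apply, mul_sum, mul_assoc])
  (fun c f g => by ext w; simp [mul_apply, smul_apply, mul_sum, mul_left_comm])

end TotalAlgebra

/-! ### Standardization and the algebra of free quasisymmetric functions -/

/-- `𝔖`, the set of all permutations of all lengths `n ≥ 0`. The one-line notation of
`⟨n, π⟩` is `π 0, π 1, …, π (n - 1)` (positions and letters counted from `0`). -/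
abbrev Perms : Type := Σ n : ℕ, Equiv.Perm (Fin n)

/-- The standardization of a word: letter `i` is replaced by its rank, where equal letters are
ranked from left to right. (`Tuple.sort` lists the positions in the order of their letters, ties
broken from left to right, so its inverse gives the ranks; see `std_eq_iff`.) -/
def std (w : List ℕ) : Perms := ⟨w.length, (Tuple.sort w.get)⁻¹⟩

theorem sort_inv_eq_iff {n : ℕ} (f : Fin n → ℕ) (τ : Equiv.Perm (Fin n)) :
    (Tuple.sort f)⁻¹ = τ ↔ ∀ i j : Fin n, i < j → (τ i < τ j ↔ f i ≤ f j) := by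
  rw [inv_eq_iff_eq_inv, eq_comm, Tuple.eq_sort_iff]
  constructor
  · rintro ⟨hm, ht⟩ i j hij
    have hm' : ∀ a b, τ a ≤ τ b → f a ≤ f b := fun a b h => by simpa using hm h
    have ht' : ∀ a b, τ a < τ b → f a = f b → a < b := fun a b h => by simpa using ht _ _ h
    refine ⟨fun h => hm' _ _ h.le, fun h => ?_⟩
    by_contra hc
    have h1 : τ j < τ i := lt_of_le_of_ne (not_lt.1 hc) (fun h => hij.ne (τ.injective h).symm)
    exact absurd (ht' _ _ h1 (le_antisymm (hm' _ _ h1.le) h)) (not_lt.2 hij.le)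
  · intro h
    have key : ∀ i j, τ i ≤ τ j → f i ≤ f j := by
      intro i j hle
      rcases lt_trichotomy i j with hij | hij | hij
      · exact (h i j hij).1 (lt_of_le_of_ne hle (fun e => hij.ne (τ.injective e)))
      · rw [hij]
      · by_contra hc
        exact absurd ((h j i hij).2 (not_le.1 hc).le) (not_lt.2 hle)
    refine ⟨fun a b hab => key _ _ (by simpa using hab), fun a b hab he => ?_⟩
    by_contra hc
    have h1 : τ⁻¹ b < τ⁻¹ a :=
      lt_of_le_of_ne (not_lt.1 hc) (fun e => hab.ne (τ⁻¹.injective e).symm)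
    have h2 := (h _ _ h1).2 he.ge
    simp at h2
    exact absurd h2 (not_lt.2 hab.le)

/-- `std w` is the permutation `τ` of the same length such that, for `i < j`, `τ i < τ j` if and
only if `w i ≤ w j`. -/
theorem std_eq_iff (w : List ℕ) (n : ℕ) (τ : Equiv.Perm (Fin n)) :
    std w = ⟨n, τ⟩ ↔ ∃ h : w.length = n, ∀ i j : Fin n, i < j →
      (τ i < τ j ↔ w.get (i.cast h.symm) ≤ w.get (j.cast h.symm)) := by
  constructor
  · intro h
    have hn : w.length = n := congrArg Sigma.fst h
    subst hn
    have := eq_of_heq (Sigma.mk.inj h).2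
    exact ⟨rfl, (sort_inv_eq_iff _ _).1 this⟩
  · rintro ⟨h, h'⟩
    subst h
    rw [std, (sort_inv_eq_iff w.get τ).2 h']

/-- The function `G_π`: the sum of all words whose standardization is `π`. -/
def G (π : Perms) : TotalAlgebra := fun w => if std w = π then 1 else 0

/-- The one-line notation of a permutation, as a word. -/
def word (π : Perms) : List ℕ := List.ofFn fun i => (π.2 i : ℕ)

theorem std_word (π : Perms) : std (word π) = π := by
  obtain ⟨n, τ⟩ := π
  rw [std_eq_iff]
  refine ⟨by simp [word], fun i j hij => ?_⟩
  have h : τ i ≠ τ j := fun e => hij.ne (τ.injective e)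
  simp only [word, List.get_ofFn]
  exact h.le_iff_lt.symm

theorem std_congr_iff (u v : List ℕ) : std u = std v ↔ u.length = v.length ∧
    ∀ i j, i < j → j < u.length → (u.getD i 0 ≤ u.getD j 0 ↔ v.getD i 0 ≤ v.getD j 0) := by
  obtain ⟨σ, hσ⟩ : ∃ σ : Equiv.Perm (Fin v.length), std v = ⟨v.length, σ⟩ := ⟨_, rfl⟩
  obtain ⟨_, hv⟩ := (std_eq_iff v v.length σ).1 hσ
  rw [hσ, std_eq_iff]
  constructor
  · rintro ⟨h, hu⟩
    refine ⟨h, fun i j hij hj => ?_⟩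
    have h1 := hu ⟨i, by omega⟩ ⟨j, by omega⟩ hij
    have h2 := hv ⟨i, by omega⟩ ⟨j, by omega⟩ hij
    rw [h1] at h2
    have hi : i < u.length := by omega
    have hi' : i < v.length := by omega
    have hj' : j < v.length := by omega
    simpa [hi, hj, hi', hj'] using h2
  · rintro ⟨h, hu⟩
    refine ⟨h, fun i j hij => ?_⟩
    rw [hv i j hij]
    have := hu i j hij (by omega)
    have hi : (i : ℕ) < u.length := by omega
    have hj : (j : ℕ) < u.length := by omega
    simpa [hi, hj] using this.symm

theorem std_take {u v : List ℕ} (h : std u = std v) (k : ℕ) : std (u.take k) = std (v.take k) := by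
  rw [std_congr_iff] at h ⊢
  refine ⟨by simp [h.1], fun i j hij hj => ?_⟩
  simp at hj
  have := h.2 i j hij hj.2
  simpa [List.getD_eq_getElem?_getD, List.getElem?_take, hj.1, hij.trans hj.1] using this

theorem std_drop {u v : List ℕ} (h : std u = std v) (k : ℕ) : std (u.drop k) = std (v.drop k) := by
  rw [std_congr_iff] at h ⊢
  refine ⟨by simp [h.1], fun i j hij hj => ?_⟩
  simp at hj
  have := h.2 (k + i) (k + j) (by omega) (by omega)
  simpa [List.getD_eq_getElem?_getD, List.getElem?_drop] using this

theorem linearIndependent_G : LinearIndependent ℚ G := by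
  rw [linearIndependent_iff']
  intro s g h π hπ
  have h1 := congrFun h (word π)
  have h2 : ∀ (s : Finset Perms) (w : List ℕ),
      (∑ i ∈ s, g i • G i : TotalAlgebra) w = ∑ i ∈ s, g i * G i w := by
    intro s w
    induction s using Finset.induction_on with
    | empty => rfl
    | insert a s ha ih =>
      rw [sum_insert ha, sum_insert ha, TotalAlgebra.add_apply, TotalAlgebra.smul_apply, ih]
  rw [h2] at h1
  simpa [G, std_word, hπ, TotalAlgebra.zero_apply] using h1

theorem sum_apply {ι : Type*} (s : Finset ι) (f : ι → TotalAlgebra) (w : List ℕ) :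
    (∑ i ∈ s, f i) w = ∑ i ∈ s, f i w := by
  induction s using Finset.cons_induction with
  | empty => rfl
  | cons a s ha ih => rw [sum_cons, sum_cons, TotalAlgebra.add_apply, ih]

theorem mem_span_G_iff (f : TotalAlgebra) : f ∈ Submodule.span ℚ (Set.range G) ↔
    (∃ N, ∀ w : List ℕ, N < w.length → f w = 0) ∧ ∀ u v, std u = std v → f u = f v := by
  constructor
  · intro hf
    induction hf using Submodule.span_induction with
    | mem f hf =>
      obtain ⟨π, rfl⟩ := hf
      refine ⟨⟨π.1, fun w hw => if_neg ?_⟩, fun u v h => by simp [G, h]⟩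
      rintro rfl
      exact lt_irrefl _ hw
    | zero => exact ⟨⟨0, fun _ _ => rfl⟩, fun _ _ _ => rfl⟩
    | add f g _ _ hf hg =>
      obtain ⟨⟨N, hN⟩, h1⟩ := hf
      obtain ⟨⟨M, hM⟩, h2⟩ := hg
      refine ⟨⟨max N M, fun w hw => ?_⟩, fun u v h => ?_⟩
      · rw [TotalAlgebra.add_apply, hN w (by omega), hM w (by omega), add_zero]
      · rw [TotalAlgebra.add_apply, TotalAlgebra.add_apply, h1 u v h, h2 u v h]
    | smul c f _ hf =>
      obtain ⟨⟨N, hN⟩, h1⟩ := hf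
      refine ⟨⟨N, fun w hw => ?_⟩, fun u v h => ?_⟩
      · rw [TotalAlgebra.smul_apply, hN w hw, mul_zero]
      · rw [TotalAlgebra.smul_apply, TotalAlgebra.smul_apply, h1 u v h]
  · rintro ⟨⟨N, hN⟩, hf⟩
    have : f = ∑ π ∈ (range (N + 1)).sigma fun n => (univ : Finset (Equiv.Perm (Fin n))),
        f (word π) • G π := by
      ext w
      simp only [sum_apply, TotalAlgebra.smul_apply, G, mul_ite, mul_one, mul_zero]
      rw [sum_ite_eq]
      split_ifs with h
      · exact hf _ _ (std_word _).symm
      · refine hN w ?_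
        simp [std] at h
        omega
    rw [this]
    exact Submodule.sum_mem _ fun π _ => Submodule.smul_mem _ _ (Submodule.subset_span ⟨π, rfl⟩)

/-- `FQSym`: the span of the `G_π`, a subalgebra of `ℚ⟨⟨A*⟩⟩`. -/
def FQSym : Subalgebra ℚ TotalAlgebra :=
  (Submodule.span ℚ (Set.range G)).toSubalgebra
    (by
      rw [mem_span_G_iff]
      refine ⟨⟨0, fun w hw => if_neg ?_⟩, fun u v h => ?_⟩
      · rintro rfl
        simp at hw
      · have := ((std_congr_iff u v).1 h).1
        simp only [TotalAlgebra.one_apply, ← List.length_eq_zero_iff, this])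
    (by
      intro f g hf hg
      rw [mem_span_G_iff] at hf hg ⊢
      obtain ⟨⟨N, hN⟩, h1⟩ := hf
      obtain ⟨⟨M, hM⟩, h2⟩ := hg
      refine ⟨⟨N + M, fun w hw => sum_eq_zero fun i hi => ?_⟩, fun u v h => ?_⟩
      · simp at hi
        by_cases hiN : N < i
        · rw [hN _ (by simp; omega), zero_mul]
        · rw [hM _ (by simp; omega), mul_zero]
      · rw [TotalAlgebra.mul_apply, TotalAlgebra.mul_apply, ((std_congr_iff u v).1 h).1]
        exact sum_congr rfl fun i _ => by
          rw [h1 _ _ (std_take h i), h2 _ _ (std_drop h i)])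

/-- The basis `{G_π}` of `FQSym`, indexed by all permutations. -/
def basisG : Module.Basis Perms ℚ FQSym := Module.Basis.span linearIndependent_G

theorem coe_basisG (π : Perms) : (basisG π : TotalAlgebra) = G π :=
  congrArg Subtype.val (Module.Basis.span_apply linearIndependent_G π)

/-! ### Compositions and descents -/

/-- The `i`-th letter `π_i` of `π` in one-line notation, with positions `1 ≤ i ≤ n` and letters
`1, …, n`. -/
def letter {n : ℕ} (π : Equiv.Perm (Fin n)) (i : ℕ) : ℕ :=
  if h : i - 1 < n then (π ⟨i - 1, h⟩ : ℕ) + 1 else 0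

/-- The descent set: all `i ∈ [n - 1]` with `π_i > π_{i+1}`. -/
def Des {n : ℕ} (π : Equiv.Perm (Fin n)) : Finset ℕ :=
  {i ∈ Icc 1 (n - 1) | letter π i > letter π (i + 1)}

/-- The set of peaks: all `i ∈ {2, …, n - 1}` with `π_{i-1} < π_i > π_{i+1}`. -/
def Pk {n : ℕ} (π : Equiv.Perm (Fin n)) : Finset ℕ :=
  {i ∈ Icc 2 (n - 1) | letter π (i - 1) < letter π i ∧ letter π i > letter π (i + 1)}

/-- The set of left peaks: all `i ∈ [n - 1]` that are a peak, or are `1` and a descent. -/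
def Lpk {n : ℕ} (π : Equiv.Perm (Fin n)) : Finset ℕ :=
  {i ∈ Icc 1 (n - 1) | i ∈ Pk π ∨ (i = 1 ∧ i ∈ Des π)}

/-- The descent number. -/
def des {n : ℕ} (π : Equiv.Perm (Fin n)) : ℕ := (Des π).card
/-- The comajor index. -/
def comaj {n : ℕ} (π : Equiv.Perm (Fin n)) : ℕ := ∑ i ∈ Des π, (n - i)
/-- The peak number. -/
def pk {n : ℕ} (π : Equiv.Perm (Fin n)) : ℕ := (Pk π).card
/-- The left peak number. -/
def lpk {n : ℕ} (π : Equiv.Perm (Fin n)) : ℕ := (Lpk π).card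

/-- The inverse descent number, `ides(π) = des(π⁻¹)`; similarly below. -/
def ides {n : ℕ} (π : Equiv.Perm (Fin n)) : ℕ := des π⁻¹
/-- The inverse comajor index. -/
def icomaj {n : ℕ} (π : Equiv.Perm (Fin n)) : ℕ := comaj π⁻¹
/-- The inverse peak number. -/
def ipk {n : ℕ} (π : Equiv.Perm (Fin n)) : ℕ := pk π⁻¹
/-- The inverse left peak number. -/
def ilpk {n : ℕ} (π : Equiv.Perm (Fin n)) : ℕ := lpk π⁻¹

/-- The descent composition of `π`: the lengths of the maximal increasing runs of `π`, in order. -/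
def Comp {n : ℕ} (π : Equiv.Perm (Fin n)) : Composition n where
  blocks := ((List.ofFn fun i => (π i : ℕ)).splitBy fun a b => decide (a < b)).map List.length
  blocks_pos := by
    intro k hk
    obtain ⟨l, hl, rfl⟩ := List.mem_map.1 hk
    exact List.length_pos_iff.2 (List.ne_nil_of_mem_splitBy hl)
  blocks_sum := by
    rw [← List.length_flatten, List.flatten_splitBy, List.length_ofFn]

/-- `Des(L) = {L₁, L₁ + L₂, …, L₁ + ⋯ + L_{k-1}}` for a composition `L = (L₁, …, L_k)`. -/
def cDes {n : ℕ} (L : Composition n) : Finset ℕ := (Ico 1 L.length).image L.sizeUpTo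

theorem runs_aux (L : List (List ℕ)) (hn : [] ∉ L) (h1 : ∀ m ∈ L, m.IsChain (· < ·))
    (h2 : L.IsChain fun a b => ∃ ha hb, ¬ a.getLast ha < b.head hb) :
    ∀ i, 0 < i → i < L.flatten.length →
      (¬ L.flatten.getD (i - 1) 0 < L.flatten.getD i 0 ↔
        ∃ k, 0 < k ∧ k < L.length ∧ ((L.map List.length).take k).sum = i) := by
  induction L with
  | nil => simp
  | cons m L ih =>
    intro i hi hil
    have ih := ih (fun h => hn (List.mem_cons_of_mem _ h))
      (fun a ha => h1 a (List.mem_cons_of_mem _ ha)) h2.of_cons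
    have hm : m ≠ [] := fun h => hn (by simp [h])
    have hm' := List.length_pos_iff.2 hm
    rw [List.flatten_cons] at hil ⊢
    rw [List.length_append] at hil
    rcases lt_trichotomy i m.length with h | h | h
    · rw [List.getD_append _ _ _ _ h, List.getD_append _ _ _ _ (by omega)]
      have hc := (List.isChain_iff_getElem.1 (h1 m (by simp))) (i - 1) (by omega)
      have e : i - 1 + 1 = i := by omega
      simp only [e] at hc
      have hi1 : i - 1 < m.length := by omega
      constructor
      · intro hh
        simp [h, hi1] at hh
        omega
      · rintro ⟨k, hk, -, hs⟩
        obtain ⟨k, rfl⟩ : ∃ j, k = j + 1 := ⟨k - 1, by omega⟩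
        simp at hs
        omega
    · subst h
      obtain ⟨b, L, rfl⟩ : ∃ b L', L = b :: L' := by
        cases L with
        | nil => simp at hil
        | cons b L => exact ⟨b, L, rfl⟩
      obtain ⟨ha, hb, hlt⟩ := (List.isChain_cons_cons.1 h2).1
      refine ⟨fun _ => ⟨1, by simp⟩, fun _ => ?_⟩
      rw [List.getD_append _ _ _ _ (by omega), List.getD_append_right _ _ _ _ le_rfl]
      have hb' := List.length_pos_iff.2 hb
      rw [List.flatten_cons, Nat.sub_self, List.getD_append _ _ _ _ hb']
      rw [List.getLast_eq_getElem, List.head_eq_getElem] at hlt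
      have : m.length - 1 < m.length := by omega
      simpa [hb', this] using hlt
    · rw [List.getD_append_right _ _ _ _ h.le, List.getD_append_right _ _ _ _ (by omega)]
      have e : i - 1 - m.length = i - m.length - 1 := by omega
      rw [e, ih (i - m.length) (by omega) (by omega)]
      constructor
      · rintro ⟨k, hk, hk', hs⟩
        exact ⟨k + 1, by omega, by simpa using hk', by simp; omega⟩
      · rintro ⟨k, hk, hk', hs⟩
        obtain ⟨k, rfl⟩ : ∃ j, k = j + 1 := ⟨k - 1, by omega⟩
        simp at hs hk'
        refine ⟨k, ?_, hk', by omega⟩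
        rcases Nat.eq_zero_or_pos k with rfl | h0
        · simp at hs; omega
        · exact h0

/-- The descent set of `π` is that of its descent composition. -/
theorem cDes_Comp {n : ℕ} (π : Equiv.Perm (Fin n)) : cDes (Comp π) = Des π := by
  have key := runs_aux ((List.ofFn fun i => (π i : ℕ)).splitBy fun a b => decide (a < b))
    (List.nil_notMem_splitBy _ _)
    (fun m hm => by simpa using List.isChain_of_mem_splitBy hm)
    (by simpa using List.isChain_getLast_head_splitBy (fun a b : ℕ => decide (a < b))
          (List.ofFn fun i => (π i : ℕ)))
  rw [List.flatten_splitBy, List.length_ofFn] at key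
  have hlen : (Comp π).length =
    ((List.ofFn fun i => (π i : ℕ)).splitBy fun a b => decide (a < b)).length := by
    simp [Composition.length, Comp]
  ext i
  have hmem : i ∈ cDes (Comp π) ↔ ∃ k, 0 < k ∧ k < (Comp π).length ∧ (Comp π).sizeUpTo k = i := by
    simp [cDes, Nat.succ_le_iff, and_assoc]
  rw [hmem]
  by_cases hi : 0 < i ∧ i < n
  · have := key i hi.1 hi.2
    rw [hlen]
    simp only [Composition.sizeUpTo, Comp]
    rw [← this]
    have hi1 : i - 1 < n := by omega
    have hne : π ⟨i - 1, hi1⟩ ≠ π ⟨i, hi.2⟩ := fun h => by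
      have := congrArg Fin.val (π.injective h)
      simp at this
      omega
    have hne' : (π ⟨i - 1, hi1⟩ : ℕ) ≠ π ⟨i, hi.2⟩ := fun h => hne (Fin.ext h)
    simp [Des, letter, hi.2, hi1]
    omega
  · constructor
    · rintro ⟨k, hk, hk', rfl⟩
      have h1 := (Comp π).sizeUpTo_strict_mono hk'
      have h2 := (Comp π).sizeUpTo_le (k + 1)
      have h3 := (Comp π).sizeUpTo_strict_mono (show 0 < (Comp π).length by omega)
      have h4 := (Comp π).monotone_sizeUpTo (show 0 + 1 ≤ k by omega)
      omega
    · intro h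
      simp [Des] at h
      omega

/-- The descent number of a composition: that of any permutation with descent composition `L`
(see `des_eq`; similarly for the next three). -/
def cdes {n : ℕ} (L : Composition n) : ℕ := (cDes L).card
/-- The comajor index of a composition. -/
def ccomaj {n : ℕ} (L : Composition n) : ℕ := ∑ i ∈ cDes L, (n - i)
/-- The peak number of a composition: peaks are the descents `i ≥ 2` such that `i - 1` is not a
descent. -/
def cpk {n : ℕ} (L : Composition n) : ℕ := {i ∈ cDes L | 2 ≤ i ∧ i - 1 ∉ cDes L}.card
/-- The left peak number of a composition: left peaks are the descents `i` such that `i - 1` is not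
a descent. -/
def clpk {n : ℕ} (L : Composition n) : ℕ := {i ∈ cDes L | i - 1 ∉ cDes L}.card

theorem mem_Des_iff {n : ℕ} (π : Equiv.Perm (Fin n)) (i : ℕ) :
    i ∈ Des π ↔ 1 ≤ i ∧ i ≤ n - 1 ∧ letter π i > letter π (i + 1) := by
  simp [Des, and_assoc]

theorem notMem_Des {n : ℕ} (π : Equiv.Perm (Fin n)) {i : ℕ} (h1 : 1 ≤ i) (h2 : i ≤ n - 1) :
    i ∉ Des π ↔ letter π i < letter π (i + 1) := by
  have hi : i < n := by omega
  have hi1 : i - 1 < n := by omega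
  have hne : (π ⟨i - 1, hi1⟩ : ℕ) ≠ π ⟨i, hi⟩ := fun h => by
    have := congrArg Fin.val (π.injective (Fin.ext h))
    simp at this
    omega
  rw [mem_Des_iff]
  simp [letter, hi, hi1, h1, h2]
  omega

theorem des_eq {n : ℕ} (π : Equiv.Perm (Fin n)) : cdes (Comp π) = des π := by
  rw [cdes, cDes_Comp, des]

theorem comaj_eq {n : ℕ} (π : Equiv.Perm (Fin n)) : ccomaj (Comp π) = comaj π := by
  rw [ccomaj, cDes_Comp, comaj]

theorem mem_Pk_iff {n : ℕ} (π : Equiv.Perm (Fin n)) (i : ℕ) :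
    i ∈ Pk π ↔ i ∈ Des π ∧ 2 ≤ i ∧ i - 1 ∉ Des π := by
  by_cases h : 2 ≤ i ∧ i ≤ n - 1
  · have := notMem_Des π (i := i - 1) (by omega) (by omega)
    rw [show i - 1 + 1 = i by omega] at this
    rw [this, mem_Des_iff]
    simp only [Pk, mem_filter, mem_Icc]
    omega
  · rw [mem_Des_iff]
    simp only [Pk, mem_filter, mem_Icc]
    tauto

theorem pk_eq {n : ℕ} (π : Equiv.Perm (Fin n)) : cpk (Comp π) = pk π := by
  rw [cpk, cDes_Comp, pk]
  congr 1
  ext i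
  rw [mem_Pk_iff, mem_filter]

theorem lpk_eq {n : ℕ} (π : Equiv.Perm (Fin n)) : clpk (Comp π) = lpk π := by
  rw [clpk, cDes_Comp, lpk]
  congr 1
  ext i
  have h0 : 0 ∉ Des π := by simp [Des]
  simp only [Lpk, mem_filter, mem_Pk_iff, mem_Icc]
  have h := mem_Des_iff π i
  by_cases h1 : i = 1
  · subst h1
    simp [h0]
    tauto
  · constructor
    · rintro ⟨ha, hb⟩
      have := h.1 ha
      exact ⟨⟨this.1, this.2.1⟩, Or.inl ⟨ha, by omega, hb⟩⟩
    · rintro ⟨-, hb | hb⟩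
      · exact ⟨hb.1, hb.2.2⟩
      · exact absurd hb.1 h1

/-! ### Quasisymmetric functions -/

/-- A power series `f` in commuting variables `x₀, x₁, …` is quasisymmetric if it has bounded degree
and, for positive integers `a₁, …, a_k`, the coefficients of `x_{i₁}^{a₁} ⋯ x_{i_k}^{a_k}` and of
`x_{j₁}^{a₁} ⋯ x_{j_k}^{a_k}` agree whenever `i₁ < ⋯ < i_k` and `j₁ < ⋯ < j_k`. -/
def IsQuasisymmetric (f : MvPowerSeries ℕ ℚ) : Prop :=
  (∃ d : ℕ, ∀ e : ℕ →₀ ℕ, d < e.degree → MvPowerSeries.coeff e f = 0) ∧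
  ∀ (k : ℕ) (a : Fin k → ℕ), (∀ l, 0 < a l) → ∀ i j : Fin k → ℕ, StrictMono i → StrictMono j →
    MvPowerSeries.coeff (∑ l, Finsupp.single (i l) (a l)) f =
      MvPowerSeries.coeff (∑ l, Finsupp.single (j l) (a l)) f

theorem sum_single_eq {k : ℕ} (a : Fin k → ℕ) (i : Fin k → ℕ) :
    ∑ l, Finsupp.single (i l) (a l) = (Finsupp.equivFunOnFinite.symm a).mapDomain i := by
  have : Finsupp.equivFunOnFinite.symm a = ∑ l, Finsupp.single l (a l) := by
    ext m
    simp [Finsupp.single_apply]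
  rw [this, Finsupp.mapDomain_finsetSum]
  simp

/-- In the definition, exponents equal to `0` may be allowed. -/
theorem IsQuasisymmetric.coeff_eq {f : MvPowerSeries ℕ ℚ} (hf : IsQuasisymmetric f) {k : ℕ}
    (a : Fin k →₀ ℕ) {i j : Fin k → ℕ} (hi : StrictMono i) (hj : StrictMono j) :
    MvPowerSeries.coeff (a.mapDomain i) f = MvPowerSeries.coeff (a.mapDomain j) f := by
  have key : ∀ i : Fin k → ℕ, a.mapDomain i = ∑ l : Fin a.support.card,
      Finsupp.single (i (a.support.orderEmbOfFin rfl l)) (a (a.support.orderEmbOfFin rfl l)) := by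
    intro i
    rw [Finsupp.mapDomain, Finsupp.sum]
    conv_lhs => rw [← Finset.image_orderEmbOfFin_univ a.support rfl]
    rw [sum_image fun _ _ _ _ h => (a.support.orderEmbOfFin rfl).injective h]
  rw [key i, key j]
  refine hf.2 _ _ (fun l => ?_) _ _ (hi.comp (OrderEmbedding.strictMono _))
    (hj.comp (OrderEmbedding.strictMono _))
  exact Nat.pos_of_ne_zero (Finsupp.mem_support_iff.1 (Finset.orderEmbOfFin_mem _ _ _))

theorem antidiagonal_mapDomain {k : ℕ} (a : Fin k →₀ ℕ) {i : Fin k → ℕ}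
    (hi : Function.Injective i) : antidiagonal (a.mapDomain i) =
      (antidiagonal a).image fun p => (p.1.mapDomain i, p.2.mapDomain i) := by
  ext ⟨u, v⟩
  simp only [HasAntidiagonal.mem_antidiagonal, mem_image, Prod.exists, Prod.mk.injEq]
  constructor
  · intro h
    have h0 : ∀ m, m ∉ Set.range i → u m = 0 ∧ v m = 0 := by
      intro m hm
      have := DFunLike.congr_fun h m
      rw [Finsupp.mapDomain_of_notMem_range _ _ hm] at this
      simpa using this
    refine ⟨u.comapDomain i hi.injOn, v.comapDomain i hi.injOn, ?_, ?_, ?_⟩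
    · ext l
      have := DFunLike.congr_fun h (i l)
      rw [Finsupp.mapDomain_apply hi] at this
      simpa using this
    · refine Finsupp.mapDomain_comapDomain i hi u fun m hm => ?_
      by_contra hc
      exact (Finsupp.mem_support_iff.1 hm) (h0 m hc).1
    · refine Finsupp.mapDomain_comapDomain i hi v fun m hm => ?_
      by_contra hc
      exact (Finsupp.mem_support_iff.1 hm) (h0 m hc).2
  · rintro ⟨p, q, rfl, rfl, rfl⟩
    rw [Finsupp.mapDomain_add]

/-- `QSym`, the algebra of quasisymmetric functions over `ℚ`. -/
def QSym : Subalgebra ℚ (MvPowerSeries ℕ ℚ) where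
  carrier := {f | IsQuasisymmetric f}
  mul_mem' := by
    rintro f g hf hg
    obtain ⟨d, hd⟩ := hf.1
    obtain ⟨d', hd'⟩ := hg.1
    refine ⟨⟨d + d', fun e he => ?_⟩, fun k a _ i j hi hj => ?_⟩
    · rw [MvPowerSeries.coeff_mul]
      refine sum_eq_zero fun p hp => ?_
      have : p.1.degree + p.2.degree = e.degree := by
        rw [← map_add, HasAntidiagonal.mem_antidiagonal.1 hp]
      by_cases h : d < p.1.degree
      · rw [hd _ h, zero_mul]
      · rw [hd' p.2 (by omega), mul_zero]
    · have inj : ∀ i : Fin k → ℕ, StrictMono i → ∀ p q : (Fin k →₀ ℕ) × (Fin k →₀ ℕ),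
          (p.1.mapDomain i, p.2.mapDomain i) = (q.1.mapDomain i, q.2.mapDomain i) → p = q := by
        intro i hi p q h
        have h' := Prod.mk.inj h
        exact Prod.ext (Finsupp.mapDomain_injective hi.injective h'.1)
          (Finsupp.mapDomain_injective hi.injective h'.2)
      rw [sum_single_eq, sum_single_eq, MvPowerSeries.coeff_mul, MvPowerSeries.coeff_mul,
        antidiagonal_mapDomain _ hi.injective, antidiagonal_mapDomain _ hj.injective,
        sum_image fun _ _ _ _ h => inj i hi _ _ h, sum_image fun _ _ _ _ h => inj j hj _ _ h]
      exact sum_congr rfl fun p _ => by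
        rw [hf.coeff_eq p.1 hi hj, hg.coeff_eq p.2 hi hj]
  add_mem' := by
    rintro f g ⟨⟨d, hd⟩, hf⟩ ⟨⟨d', hd'⟩, hg⟩
    refine ⟨⟨max d d', fun e he => ?_⟩, fun k a ha i j hi hj => ?_⟩
    · rw [map_add, hd e (by omega), hd' e (by omega), add_zero]
    · rw [map_add, map_add, hf k a ha i j hi hj, hg k a ha i j hi hj]
  algebraMap_mem' := by
    intro c
    refine ⟨⟨0, fun e he => ?_⟩, fun k a ha i j hi hj => ?_⟩
    · rw [MvPowerSeries.algebraMap_apply, MvPowerSeries.coeff_C, if_neg]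
      rintro rfl
      simp at he
    · rw [MvPowerSeries.algebraMap_apply, MvPowerSeries.coeff_C, MvPowerSeries.coeff_C,
        sum_single_eq, sum_single_eq]
      have : ∀ i : Fin k → ℕ, StrictMono i → ((Finsupp.equivFunOnFinite.symm a).mapDomain i = 0 ↔
          Finsupp.equivFunOnFinite.symm a = 0) := fun i hi =>
        (Finsupp.mapDomain_injective hi.injective).eq_iff' Finsupp.mapDomain_zero
      rw [if_congr (this i hi) rfl rfl, if_congr (this j hj) rfl rfl]

open scoped Classical in
/-- The sum of all monomials `x_{i₁} ⋯ x_{iₙ}` with `i₁ ≤ ⋯ ≤ iₙ` and `i_j < i_{j+1}` whenever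
`j ∈ Des(L)`. A weakly increasing sequence is determined by its monomial, so that every coefficient
is `0` or `1`. -/
def fundamentalSeries {n : ℕ} (L : Composition n) : MvPowerSeries ℕ ℚ := fun e =>
  if ∃ i : Fin n → ℕ, Monotone i ∧
      (∀ j k : Fin n, (k : ℕ) = j + 1 → (k : ℕ) ∈ cDes L → i j < i k) ∧
      ∑ j, Finsupp.single (i j) 1 = e
  then 1 else 0

theorem isQuasisymmetric_fundamentalSeries {n : ℕ} (L : Composition n) :
    IsQuasisymmetric (fundamentalSeries L) := by
  refine ⟨⟨n, fun e he => if_neg ?_⟩, fun k a _ i j hi hj => ?_⟩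
  · rintro ⟨i, -, -, rfl⟩
    simp at he
  · have key : ∀ i j : Fin k → ℕ, StrictMono i → StrictMono j →
        (∃ s : Fin n → ℕ, Monotone s ∧
          (∀ j k : Fin n, (k : ℕ) = j + 1 → (k : ℕ) ∈ cDes L → s j < s k) ∧
          ∑ l, Finsupp.single (s l) 1 = ∑ l, Finsupp.single (i l) (a l)) →
        (∃ s : Fin n → ℕ, Monotone s ∧
          (∀ j k : Fin n, (k : ℕ) = j + 1 → (k : ℕ) ∈ cDes L → s j < s k) ∧
          ∑ l, Finsupp.single (s l) 1 = ∑ l, Finsupp.single (j l) (a l)) := by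
      rintro i j hi hj ⟨s, hs, hs', h⟩
      have hr : ∀ l, ∃ m, i m = s l := by
        intro l
        by_contra hc
        have h1 := DFunLike.congr_fun h (s l)
        rw [sum_single_eq a, Finsupp.mapDomain_of_notMem_range _ _ (by simpa using hc)] at h1
        rw [Finsupp.finsetSum_apply, sum_eq_zero_iff] at h1
        simpa using h1 l (mem_univ l)
      choose c hc using hr
      refine ⟨fun l => j (c l), fun l m hlm => ?_, fun l m hlm hm => ?_, ?_⟩
      · exact hj.monotone (hi.le_iff_le.1 (by rw [hc, hc]; exact hs hlm))
      · exact hj (hi.lt_iff_lt.1 (by rw [hc, hc]; exact hs' l m hlm hm))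
      · have e1 : ∀ i : Fin k → ℕ, ∑ l, Finsupp.single (i (c l)) 1 =
            (∑ l, Finsupp.single (c l) 1 : Fin k →₀ ℕ).mapDomain i := by
          intro i
          rw [Finsupp.mapDomain_finsetSum]
          simp
        simp only [← hc] at h
        rw [e1, sum_single_eq] at h ⊢
        rw [Finsupp.mapDomain_injective hi.injective h]
    classical
    exact if_congr ⟨key i j hi hj, key j i hj hi⟩ rfl rfl

/-- The fundamental quasisymmetric function `F_L`. -/
def F {n : ℕ} (L : Composition n) : QSym :=
  ⟨fundamentalSeries L, isQuasisymmetric_fundamentalSeries L⟩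

/-- The linear map `ρ : FQSym → QSym` with `ρ(G_π) = F_{Comp(π⁻¹)}`. -/
def rho : FQSym →ₗ[ℚ] QSym := basisG.constr ℚ fun π => F (Comp π.2⁻¹)

/-! ### Hadamard products and the maps `Ψ` -/

/-- `R[[t*]]`: formal power series `∑ aₖ tᵏ` over `R`, given by their coefficients, with the
Hadamard product `(∑ aₖ tᵏ) * (∑ bₖ tᵏ) = ∑ aₖ bₖ tᵏ`. For `R = K[[x]]` this is `K[[t*, x]]`. -/
def HadamardSeries (R : Type*) : Type _ := ℕ → R

namespace HadamardSeries

variable {R : Type*} [CommRing R]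

instance : CommRing (HadamardSeries R) := inferInstanceAs (CommRing (ℕ → R))
instance [Algebra ℚ R] : Algebra ℚ (HadamardSeries R) := inferInstanceAs (Algebra ℚ (ℕ → R))

/-- A power series in `t`, viewed as an element of `R[[t*]]`. -/
def of (f : PowerSeries R) : HadamardSeries R := fun k => PowerSeries.coeff k f

end HadamardSeries

/-- `ℚ[[t*, x]]` -/
abbrev Htx : Type := HadamardSeries (PowerSeries ℚ)
/-- `ℚ[[t*, q, x]]` -/
abbrev Htqx : Type := HadamardSeries (PowerSeries (PowerSeries ℚ))

section series

variable {K : Type*} [CommRing K]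

/-- The variable `t` of `K[[x]][[t]]`. -/
abbrev tVar : PowerSeries (PowerSeries K) := PowerSeries.X
/-- The variable `x` of `K[[x]][[t]]`. -/
abbrev xVar : PowerSeries (PowerSeries K) := PowerSeries.C PowerSeries.X
/-- The variable `q` of `ℚ[[q]][[x]][[t]]`. -/
abbrev qVar : PowerSeries (PowerSeries (PowerSeries ℚ)) :=
  PowerSeries.C (PowerSeries.C PowerSeries.X)

/-- `1 / f` for a power series `f` in `t` with constant coefficient `1`. -/
abbrev recip (f : PowerSeries (PowerSeries K)) : PowerSeries (PowerSeries K) :=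
  PowerSeries.invOfUnit f 1

theorem mul_recip (f : PowerSeries (PowerSeries K)) (hf : PowerSeries.constantCoeff f = 1) :
    f * recip f = 1 := PowerSeries.mul_invOfUnit f 1 (by simpa using hf)

end series

/-- `t^{d+1} q^c / ∏_{i=0}^n (1 - t qⁱ) xⁿ`, and `1 / (1 - t)` if `n = 0`. -/
def desComajSeries (n d c : ℕ) : Htqx :=
  if n = 0 then .of (recip (1 - tVar))
  else .of (tVar ^ (d + 1) * qVar ^ c *
    recip (∏ i ∈ range (n + 1), (1 - tVar * qVar ^ i)) * xVar ^ n)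

/-- `2^{2p+1} t^{p+1} (1 + t)^{n-2p-1} / (1 - t)^{n+1} xⁿ`, and `1 / (1 - t)` if `n = 0`. -/
def pkSeries (n p : ℕ) : Htx :=
  if n = 0 then .of (recip (1 - tVar))
  else .of (2 ^ (2 * p + 1) * tVar ^ (p + 1) * (1 + tVar) ^ (n - 2 * p - 1) *
    recip ((1 - tVar) ^ (n + 1)) * xVar ^ n)

/-- `2^{2p} t^p (1 + t)^{n-2p} / (1 - t)^{n+1} xⁿ`. -/
def lpkSeries (n p : ℕ) : Htx :=
  .of (2 ^ (2 * p) * tVar ^ p * (1 + tVar) ^ (n - 2 * p) *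
    recip ((1 - tVar) ^ (n + 1)) * xVar ^ n)

/-- The map `Ψ_(ides,icomaj)`, defined on the basis of the `G_π` and extended linearly. -/
def PsiIdesIcomaj : FQSym →ₗ[ℚ] Htqx :=
  basisG.constr ℚ fun π => desComajSeries π.1 (ides π.2) (icomaj π.2)

/-- The map `Ψ_ipk`. -/
def PsiIpk : FQSym →ₗ[ℚ] Htx := basisG.constr ℚ fun π => pkSeries π.1 (ipk π.2)

/-- The map `Ψ_ilpk`. -/
def PsiIlpk : FQSym →ₗ[ℚ] Htx := basisG.constr ℚ fun π => lpkSeries π.1 (ilpk π.2)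

/-- The `st`-equivalence of compositions: `L ∼ K` if `|L| = |K|` and `st(L) = st(K)`. -/
def stSetoid {α : Type*} (st : ∀ {n : ℕ}, Composition n → α) : Setoid (Σ n, Composition n) :=
  Setoid.ker fun L => (L.1, st L.2)

/-- `φ` is the homomorphism `φ_st : QSym → 𝒜_st` onto a shuffle algebra of the descent statistic
`st`: its image `𝒜_st` has a basis `u` indexed by the `st`-equivalence classes of compositions such
that `φ(F_L) = u_α` whenever `L` lies in the class `α`. -/
def IsShuffleAlgebraHom {α : Type*} (st : ∀ {n : ℕ}, Composition n → α) {H : Type*} [CommRing H]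
    [Algebra ℚ H] (φ : QSym →ₐ[ℚ] H) : Prop :=
  ∃ u : Module.Basis (Quotient (stSetoid st)) ℚ φ.range,
    ∀ (n : ℕ) (L : Composition n), φ (F L) = u (Quotient.mk _ ⟨n, L⟩)

end FreeQSym

end

open FreeQSym

/-!
# Shuffle algebras of descent statistics

The coefficients of `t ^ k` in the three families of power series enumerate sequences over finite
alphabets whose letters are positive or negative. A sequence of letters counted by the fundamental
quasisymmetric function `F_L` increases weakly, and a letter can be repeated at a position outside
`Des(L)` if it is positive, at a position in `Des(L)` if it is negative (`SignedAdmissible`). The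
alphabets are

* `k` positive letters of weights `1, q, …, q ^ (k - 1)`, for `(des, comaj)`;
* `2 * k` letters with signs `-, +, -, +, …`, for `pk`;
* `2 * k + 1` letters with signs `+, -, +, -, …`, for `lpk`.

Words over such an alphabet have a standardization, which ranks equal positive letters from left to
right and equal negative ones from right to left. It is compatible with passing to factors of words.
So the elements of `FQSym`, whose coefficients only depend on the standardization of words, can be
evaluated at words over the signed alphabet in a multiplicative way; on passing to commuting letters
one obtains a homomorphism `spec` from `FQSym` to power series in `x`. Sorting the letters of a word
turns the words with standardization `π` into the admissible sequences for `Des(π⁻¹)`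
(`signedAdmissible_comp_inv_iff`), so that `spec` sends `G_π` to their enumerator (`spec_basisG`).
As the Hadamard product is the product coefficient by coefficient, the maps `Ψ` are homomorphisms
once the generating functions of the enumerators have been computed. This is done by recursion on
the length and the largest letter (`enum_succ`, `qEnumSeries_mul`, `alternating_series`).

The map `ρ` is a homomorphism since it is the passage to commuting variables (`coe_rho`), and it is
surjective since every composition is a descent composition and the `F_L` span `QSym` (`span_F`). As
they form a basis, a map `Ψ` whose value at `G_π` depends only on the descent composition of `π⁻¹`
factors linearly through `ρ`, and the factor `φ` is multiplicative because `ρ` is surjective and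
multiplicative (`exists_factorization`). Finally, the values of `φ` for different classes are
linearly independent, because they differ in the degree in `x`, in the order in `t`, or in the
leading coefficient (`isShuffleAlgebraHom_of_leading`).
-/

noncomputable section

namespace FreeQSym

/-! ### Words over a signed alphabet -/

/-- The relation required between the consecutive letters `x, y` of a sequence, at the positions
`k, k + 1` (counted from `1`): the sequence increases weakly, and a letter can be repeated only if
it is positive and `k` is not in `D`, or negative and `k` is in `D`. The set of positive letters is
given by `s`. -/
def SignedStep (s : ℕ → Prop) (D : Finset ℕ) (k x y : ℕ) : Prop :=
  x < y ∨ x = y ∧ (s x ↔ k ∉ D)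

/-- The sequences enumerated by the fundamental quasisymmetric function with descent set `D`, over
the alphabet `ℕ` whose positive letters are given by `s`. -/
def SignedAdmissible (s : ℕ → Prop) (D : Finset ℕ) {n : ℕ} (a : Fin n → ℕ) : Prop :=
  ∀ j k : Fin n, (k : ℕ) = j + 1 → SignedStep s D k (a j) (a k)

theorem SignedAdmissible.monotone {s : ℕ → Prop} {D : Finset ℕ} {n : ℕ} {a : Fin n → ℕ}
    (h : SignedAdmissible s D a) : Monotone a := by
  cases n with
  | zero => exact fun i => i.elim0
  | succ n =>
    refine Fin.monotone_iff_le_succ.2 fun i => ?_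
    rcases h i.castSucc i.succ (by simp) with h | h
    · exact h.le
    · exact h.1.le

theorem mem_Des_iff_lt {n : ℕ} (π : Equiv.Perm (Fin n)) {j k : Fin n} (h : (k : ℕ) = j + 1) :
    (k : ℕ) ∈ Des π ↔ π k < π j := by
  rw [mem_Des_iff, h]
  have hj := j.2
  have hk := k.2
  have e : (⟨j + 1, by omega⟩ : Fin n) = k := Fin.ext h.symm
  have h1 : (j : ℕ) + 1 < n := by omega
  simp [letter, h1, e]
  omega

/-- The condition that `π` standardizes the word `w` over a signed alphabet (equal positive letters
being ranked from left to right, equal negative ones from right to left), read off from the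
rearrangement of `w` in the order of the ranks. -/
theorem signedAdmissible_comp_inv_iff (s : ℕ → Prop) {n : ℕ} (π : Equiv.Perm (Fin n))
    (w : Fin n → ℕ) : SignedAdmissible s (Des π⁻¹) (w ∘ ⇑π⁻¹) ↔
      ∀ i j : Fin n, i < j → (π i < π j ↔ w i < w j ∨ w i = w j ∧ s (w i)) := by
  constructor
  · intro h
    have hm := h.monotone
    -- On a block of equal letters `π⁻¹` is monotone or antitone, according to the sign.
    have block : ∀ (d : ℕ) (p r : Fin n), (r : ℕ) = p + d + 1 → w (π⁻¹ p) = w (π⁻¹ r) →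
        (s (w (π⁻¹ p)) → π⁻¹ p < π⁻¹ r) ∧ (¬ s (w (π⁻¹ p)) → π⁻¹ r < π⁻¹ p) := by
      intro d
      induction d with
      | zero =>
        intro p r hr he
        have h1 := h p r hr
        simp only [SignedStep, Function.comp, he, lt_irrefl, false_or, true_and,
          mem_Des_iff_lt π⁻¹ hr] at h1
        rw [he, h1]
        have : π⁻¹ p ≠ π⁻¹ r := fun e => by
          have := congrArg Fin.val (π⁻¹.injective e); omega
        exact ⟨fun h => lt_of_le_of_ne (not_lt.1 h) this, fun h => not_not.1 h⟩
      | succ d ih =>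
        intro p r hr he
        have hq : (p : ℕ) + d + 1 < n := by omega
        obtain ⟨q, hq⟩ : ∃ q : Fin n, (q : ℕ) = p + d + 1 := ⟨⟨_, hq⟩, rfl⟩
        have h1 : w (π⁻¹ p) ≤ w (π⁻¹ q) := hm (Fin.le_def.2 (by omega))
        have h2 : w (π⁻¹ q) ≤ w (π⁻¹ r) := hm (Fin.le_def.2 (by omega))
        have e1 : w (π⁻¹ p) = w (π⁻¹ q) := by omega
        have e2 : w (π⁻¹ q) = w (π⁻¹ r) := by omega
        have i1 := ih p q hq e1
        have h3 := h q r (by omega)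
        simp only [SignedStep, Function.comp, e2, lt_irrefl, false_or, true_and,
          mem_Des_iff_lt π⁻¹ (show (r : ℕ) = q + 1 by omega)] at h3
        rw [he] at i1 ⊢
        rw [h3] at i1 ⊢
        have : π⁻¹ q ≠ π⁻¹ r := fun e => by
          have := congrArg Fin.val (π⁻¹.injective e); omega
        exact ⟨fun h => (i1.1 h).trans (lt_of_le_of_ne (not_lt.1 h) this),
          fun h => (not_not.1 h).trans (i1.2 h)⟩
    intro i j hij
    have key : ∀ i j, π i < π j → w i ≤ w j ∧ (w i = w j →
        (s (w i) → i < j) ∧ (¬ s (w i) → j < i)) := by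
      intro i j hlt
      have h1 := hm hlt.le
      have h2 := block (π j - π i - 1) (π i) (π j) (by have := Fin.lt_def.1 hlt; omega)
      simp only [Function.comp, Equiv.Perm.coe_inv, Equiv.symm_apply_apply] at h1 h2
      exact ⟨h1, h2⟩
    constructor
    · intro hlt
      obtain ⟨h1, h2⟩ := key i j hlt
      rcases h1.lt_or_eq with h1 | h1
      · exact Or.inl h1
      · refine Or.inr ⟨h1, ?_⟩
        by_contra hs
        exact absurd ((h2 h1).2 hs) (not_lt.2 hij.le)
    · intro hw
      by_contra hc
      have hlt : π j < π i :=
        lt_of_le_of_ne (not_lt.1 hc) fun e => hij.ne (π.injective e).symm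
      obtain ⟨h1, h2⟩ := key j i hlt
      rcases hw with hw | ⟨hw, hs⟩
      · omega
      · exact absurd ((h2 hw.symm).1 (hw ▸ hs)) (not_lt.2 hij.le)
  · intro h j k hk
    simp only [SignedStep, Function.comp, mem_Des_iff_lt π⁻¹ hk, not_lt]
    have hjk : j < k := Fin.lt_def.2 (by omega)
    have hne : π⁻¹ j ≠ π⁻¹ k := fun e => hjk.ne (π⁻¹.injective e)
    rcases hne.lt_or_gt with hlt | hlt
    · have := h _ _ hlt
      simp only [Equiv.Perm.coe_inv] at hlt ⊢
      simp only [Equiv.Perm.coe_inv, Equiv.apply_symm_apply, hjk, true_iff] at this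
      simpa [hlt.le] using this
    · have := h _ _ hlt
      simp only [Equiv.Perm.coe_inv] at hlt ⊢
      simp only [Equiv.Perm.coe_inv, Equiv.apply_symm_apply, hjk.not_gt, false_iff, not_or, not_and,
        not_lt] at this
      rcases this.1.lt_or_eq with h1 | h1
      · exact Or.inl h1
      · have h2 := this.2 h1.symm
        rw [← h1] at h2
        exact Or.inr ⟨h1, by simpa [hlt.not_ge] using h2⟩

/-- A word whose standardization in the usual sense is that of the word `w` over the signed
alphabet with positive letters `s`. -/
def unsign (s : ℕ → Prop) [DecidablePred s] (w : List ℕ) : List ℕ :=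
  w.mapIdx fun i a => a * (w.length + 1) + if s a then 0 else w.length - i

section

variable (s : ℕ → Prop) [DecidablePred s]

theorem length_unsign (w : List ℕ) : (unsign s w).length = w.length := by simp [unsign]

theorem unsign_le_iff (w : List ℕ) {i j : ℕ} (hij : i < j) (hj : j < w.length) :
    (unsign s w).getD i 0 ≤ (unsign s w).getD j 0 ↔
      w.getD i 0 < w.getD j 0 ∨ w.getD i 0 = w.getD j 0 ∧ s (w.getD i 0) := by
  have hi : i < w.length := hij.trans hj
  simp only [unsign, List.getD_eq_getElem?_getD, List.getElem?_mapIdx, hi, hj,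
    List.getElem?_eq_getElem, Option.map_some, Option.getD_some]
  rcases lt_trichotomy w[i] w[j] with h | h | h
  · simp only [h, true_or, iff_true]
    have : (w[i] + 1) * (w.length + 1) ≤ w[j] * (w.length + 1) := Nat.mul_le_mul_right _ h
    rw [add_mul, one_mul] at this
    split_ifs <;> omega
  · simp only [h, lt_irrefl, false_or, true_and]
    split_ifs with hs
    · simp [hs]
    · simp only [hs, iff_false]
      omega
  · simp only [h.not_gt, h.ne', false_or, false_and, iff_false]
    have : (w[j] + 1) * (w.length + 1) ≤ w[i] * (w.length + 1) := Nat.mul_le_mul_right _ h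
    rw [add_mul, one_mul] at this
    split_ifs <;> omega

theorem std_unsign_take (w : List ℕ) (k : ℕ) :
    std (unsign s (w.take k)) = std ((unsign s w).take k) := by
  rw [std_congr_iff]
  refine ⟨by simp [length_unsign], fun i j hij hj => ?_⟩
  rw [length_unsign] at hj
  have hj' := hj
  rw [List.length_take, lt_inf_iff] at hj'
  have e : ∀ (v : List ℕ) (l : ℕ), l < k → (v.take k).getD l 0 = v.getD l 0 := fun v l hl => by
    simp [List.getD_eq_getElem?_getD, hl]
  rw [unsign_le_iff s _ hij hj, e _ _ hj'.1, e _ _ (hij.trans hj'.1), e _ _ hj'.1,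
    e _ _ (hij.trans hj'.1), unsign_le_iff s _ hij hj'.2]

theorem std_unsign_drop (w : List ℕ) (k : ℕ) :
    std (unsign s (w.drop k)) = std ((unsign s w).drop k) := by
  rw [std_congr_iff]
  refine ⟨by simp [length_unsign], fun i j hij hj => ?_⟩
  rw [length_unsign] at hj
  have hj' := hj
  rw [List.length_drop] at hj'
  have e : ∀ (v : List ℕ) (l : ℕ), (v.drop k).getD l 0 = v.getD (k + l) 0 := fun v l => by
    simp [List.getD_eq_getElem?_getD, List.getElem?_drop]
  rw [unsign_le_iff s _ hij hj, e, e, e, e, unsign_le_iff s _ (by omega) (by omega)]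

theorem std_unsign_ofFn {n : ℕ} (w : Fin n → ℕ) (π : Equiv.Perm (Fin n)) :
    std (unsign s (List.ofFn w)) = ⟨n, π⟩ ↔ SignedAdmissible s (Des π⁻¹) (w ∘ ⇑π⁻¹) := by
  rw [signedAdmissible_comp_inv_iff, std_eq_iff]
  have hl : (unsign s (List.ofFn w)).length = n := by simp [length_unsign]
  have key : ∀ i j : Fin n, i < j → ((unsign s (List.ofFn w)).get (i.cast hl.symm) ≤
      (unsign s (List.ofFn w)).get (j.cast hl.symm) ↔ w i < w j ∨ w i = w j ∧ s (w i)) := by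
    intro i j hij
    have := unsign_le_iff s (List.ofFn w) (i := i) (j := j) hij (by simp)
    have hi : (i : ℕ) < (unsign s (List.ofFn w)).length := by omega
    have hj : (j : ℕ) < (unsign s (List.ofFn w)).length := by omega
    simpa [List.getD_eq_getElem, hi, hj] using this
  constructor
  · rintro ⟨_, h⟩ i j hij
    rw [h i j hij, key i j hij]
  · intro h
    refine ⟨hl, fun i j hij => ?_⟩
    rw [h i j hij, key i j hij]

/-- The evaluation of `f` at words over a signed alphabet. -/
def evalSigned (f : TotalAlgebra) : TotalAlgebra := fun w => f (unsign s w)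

theorem evalSigned_apply (f : TotalAlgebra) (w : List ℕ) : evalSigned s f w = f (unsign s w) := rfl

/-- Elements of `FQSym` may be evaluated at words over a signed alphabet, and this is compatible
with the product, since standardization is compatible with factors of words. -/
theorem evalSigned_mul {f g : TotalAlgebra} (hf : f ∈ FQSym) (hg : g ∈ FQSym) :
    evalSigned s (f * g) = evalSigned s f * evalSigned s g := by
  have hf' := ((mem_span_G_iff f).1 hf).2
  have hg' := ((mem_span_G_iff g).1 hg).2
  ext w
  rw [evalSigned_apply, TotalAlgebra.mul_apply, TotalAlgebra.mul_apply, length_unsign]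
  exact sum_congr rfl fun i _ => by
    rw [evalSigned_apply, evalSigned_apply, hf' _ _ (std_unsign_take s w i),
      hg' _ _ (std_unsign_drop s w i)]

end

/-! ### Specializations of `FQSym` -/

section

variable {R : Type*} [CommRing R] [Algebra ℚ R] (wt : ℕ → R) (m : ℕ)

/-- The commutative image of the part of `f` in the letters `0, …, m - 1`, where the letter `i` is
sent to `wt i * x`. -/
def wordSum (f : TotalAlgebra) : PowerSeries R :=
  PowerSeries.mk fun n => ∑ w : Fin n → Fin m,
    f (List.ofFn fun i => (w i : ℕ)) • ∏ i, wt (w i)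

theorem wordSum_mul (f g : TotalAlgebra) :
    wordSum wt m (f * g) = wordSum wt m f * wordSum wt m g := by
  ext n
  rw [PowerSeries.coeff_mul]
  simp only [wordSum, PowerSeries.coeff_mk, TotalAlgebra.mul_apply, sum_smul, List.length_ofFn]
  rw [sum_comm, ← Finset.Nat.sum_antidiagonal_eq_sum_range_succ (fun a _ => ∑ w : Fin n → Fin m,
    (f ((List.ofFn fun i => (w i : ℕ)).take a) * g ((List.ofFn fun i => (w i : ℕ)).drop a)) •
      ∏ i, wt (w i))]
  refine sum_congr rfl fun p hp => ?_
  obtain ⟨a, b⟩ := p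
  obtain rfl := HasAntidiagonal.mem_antidiagonal.1 hp
  rw [← (Fin.appendEquiv a b).sum_comp, Fintype.sum_prod_type, sum_mul_sum]
  refine sum_congr rfl fun u _ => sum_congr rfl fun v _ => ?_
  have e : (List.ofFn fun i => ((Fin.appendEquiv a b (u, v)) i : ℕ)) =
      (List.ofFn fun i => (u i : ℕ)) ++ List.ofFn fun i => (v i : ℕ) := by
    rw [← List.ofFn_fin_append]
    congr 1
    ext i
    refine Fin.addCases (fun i => ?_) (fun i => ?_) i <;> simp [Fin.appendEquiv]
  rw [e, List.take_left' (by simp), List.drop_left' (by simp), Fin.prod_univ_add]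
  simp [Fin.appendEquiv, smul_smul, mul_comm]

variable (s : ℕ → Prop) [DecidablePred s]

/-- The specialization of `FQSym` at the alphabet consisting of the letters `0, …, m - 1`, the
letters in `s` being positive and the others negative, where the letter `i` has the weight
`wt i * x`. -/
def spec : FQSym →ₐ[ℚ] PowerSeries R :=
  AlgHom.ofLinearMap
    { toFun := fun f => wordSum wt m (evalSigned s f.1)
      map_add' := fun f g => by
        ext n
        simp [wordSum, evalSigned_apply, TotalAlgebra.add_apply, add_smul, sum_add_distrib]
      map_smul' := fun c f => by
        ext n
        simp [wordSum, evalSigned_apply, TotalAlgebra.smul_apply, mul_smul, smul_sum] }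
    (by
      ext n
      cases n with
      | zero => simp [wordSum, evalSigned_apply, TotalAlgebra.one_apply, unsign]
      | succ n => simp [wordSum, evalSigned_apply, TotalAlgebra.one_apply, unsign,
        PowerSeries.coeff_one])
    (fun f g => by
      change wordSum wt m (evalSigned s (f.1 * g.1)) = _
      rw [evalSigned_mul s f.2 g.2, wordSum_mul]
      rfl)

open scoped Classical in
/-- The enumerator, with weights `wt`, of the admissible sequences of length `n` in the letters
`0, …, m - 1`. -/
def enum (D : Finset ℕ) (n : ℕ) : R :=
  ∑ a ∈ (Fintype.piFinset fun _ : Fin n => range m) with SignedAdmissible s D a, ∏ i, wt (a i)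

theorem spec_basisG {n : ℕ} (π : Equiv.Perm (Fin n)) :
    spec wt m s (basisG ⟨n, π⟩) = PowerSeries.monomial n (enum wt m s (Des π⁻¹) n) := by
  classical
  ext l
  rw [PowerSeries.coeff_monomial]
  simp only [spec, AlgHom.ofLinearMap_apply, LinearMap.coe_mk, AddHom.coe_mk, coe_basisG, wordSum,
    evalSigned_apply,    PowerSeries.coeff_mk, G]
  split_ifs with hl
  · subst hl
    simp only [std_unsign_ofFn, ite_smul, one_smul, zero_smul]
    rw [← sum_filter, enum]
    refine sum_bij' (fun w _ => fun i => (w (π⁻¹ i) : ℕ))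
      (fun a ha i => ⟨a (π i), by simpa using Fintype.mem_piFinset.1 (mem_filter.1 ha).1 (π i)⟩)
      ?_ ?_ ?_ ?_ ?_
    · intro w hw
      simp only [mem_filter, mem_univ, true_and] at hw
      simp only [mem_filter, Fintype.mem_piFinset, mem_range]
      exact ⟨fun i => (w _).2, hw⟩
    · intro a ha
      simp only [mem_filter, Fintype.mem_piFinset, mem_range] at ha
      simp only [mem_filter, mem_univ, true_and]
      convert ha.2 using 1
      ext i
      simp
    · intro w _
      ext i
      simp
    · intro a _
      ext i
      simp
    · intro w _
      exact (Equiv.prod_comp (π⁻¹ : Equiv.Perm (Fin l)) fun i => wt (w i)).symm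
  · refine sum_eq_zero fun w _ => ?_
    rw [if_neg, zero_smul]
    intro h
    have := congrArg Sigma.fst h
    simp [std, length_unsign] at this
    exact hl this

end

/-! ### The fundamental basis of `QSym` -/

/-- A triangularity criterion for linear independence: the functional `l i` is nonzero at `v i`, and
vanishes at every other vector whose rank is not smaller. -/
theorem linearIndependent_of_triangular {ι V : Type*} [AddCommGroup V] [Module ℚ V] (v : ι → V)
    (rank : ι → ℕ) (l : ι → V →ₗ[ℚ] ℚ) (hl : ∀ i, l i (v i) ≠ 0)
    (h0 : ∀ i j, j ≠ i → rank i ≤ rank j → l i (v j) = 0) : LinearIndependent ℚ v := by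
  rw [linearIndependent_iff']
  intro s g hg
  have key : ∀ r, ∀ i ∈ s, rank i = r → g i = 0 := by
    intro r
    induction r using Nat.strong_induction_on with
    | _ r ih =>
      intro i hi hr
      have h := congrArg (l i) hg
      rw [map_sum, map_zero, sum_eq_single i] at h
      · simpa [hl i] using h
      · intro j hj hji
        rw [map_smul]
        by_cases hc : rank i ≤ rank j
        · rw [h0 i j hji hc, smul_zero]
        · rw [ih (rank j) (by omega) j hj rfl, zero_smul]
      · exact fun h => absurd hi h
  exact fun i hi => key _ i hi rfl

theorem mem_cDes_iff {n : ℕ} (L : Composition n) (i : ℕ) :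
    i ∈ cDes L ↔ 0 < i ∧ i < n ∧ ∃ k, k ≤ L.length ∧ L.sizeUpTo k = i := by
  simp only [cDes, mem_image, mem_Ico]
  have hmono : ∀ {a b}, a < b → b ≤ L.length → L.sizeUpTo a < L.sizeUpTo b := fun {a b} hab hb =>
    (L.sizeUpTo_strict_mono (by omega)).trans_le (L.monotone_sizeUpTo hab)
  constructor
  · rintro ⟨k, ⟨h1, h2⟩, rfl⟩
    refine ⟨?_, ?_, k, h2.le, rfl⟩
    · have := hmono (show 0 < k by omega) h2.le
      omega
    · have := hmono h2 le_rfl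
      rwa [L.sizeUpTo_length] at this
  · rintro ⟨h1, h2, k, hk, rfl⟩
    refine ⟨k, ⟨?_, ?_⟩, rfl⟩
    · by_contra hc
      obtain rfl : k = 0 := by omega
      simp at h1
    · rcases hk.lt_or_eq with h | rfl
      · exact h
      · rw [L.sizeUpTo_length] at h2
        exact absurd h2 (lt_irrefl _)

theorem cDes_injective {n : ℕ} : Function.Injective (cDes : Composition n → Finset ℕ) := by
  intro L K h
  apply (compositionEquiv n).injective
  apply CompositionAsSet.ext
  have key : ∀ (L : Composition n) (i : Fin (n + 1)),
      i ∈ L.boundaries ↔ (i : ℕ) = 0 ∨ (i : ℕ) = n ∨ (i : ℕ) ∈ cDes L := by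
    intro L i
    have h1 : i ∈ L.boundaries ↔ ∃ k, k ≤ L.length ∧ L.sizeUpTo k = i := by
      simp only [Composition.boundaries, mem_map, mem_univ, true_and]
      constructor
      · rintro ⟨k, rfl⟩
        exact ⟨k, Nat.lt_succ_iff.1 k.2, rfl⟩
      · rintro ⟨k, hk, hi⟩
        exact ⟨⟨k, Nat.lt_succ_iff.2 hk⟩, Fin.ext hi⟩
    rw [h1, mem_cDes_iff]
    have hi := i.2
    constructor
    · intro h
      by_cases h0 : (i : ℕ) = 0
      · exact Or.inl h0
      · by_cases hn : (i : ℕ) = n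
        · exact Or.inr (Or.inl hn)
        · exact Or.inr (Or.inr ⟨by omega, by omega, h⟩)
    · rintro (h | h | h)
      · exact ⟨0, by omega, by simp [h]⟩
      · exact ⟨L.length, le_rfl, by rw [L.sizeUpTo_length, h]⟩
      · exact h.2.2
  change L.boundaries = K.boundaries
  ext i
  rw [key, key, h]

theorem cDes_subset {n : ℕ} (L : Composition n) {i : ℕ} (hi : i ∈ cDes L) : 0 < i ∧ i < n :=
  ⟨((mem_cDes_iff L i).1 hi).1, ((mem_cDes_iff L i).1 hi).2.1⟩

/-- Every composition is the descent composition of a permutation, namely of the standardization of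
a weakly decreasing word whose strict descents are prescribed. -/
theorem exists_Comp_eq {n : ℕ} (L : Composition n) : ∃ π : Equiv.Perm (Fin n), Comp π = L := by
  let f : Fin n → ℕ := fun i => #{d ∈ cDes L | (i : ℕ) < d}
  refine ⟨(Tuple.sort f)⁻¹, cDes_injective ?_⟩
  have h := (sort_inv_eq_iff f _).1 rfl
  rw [cDes_Comp]
  ext d
  by_cases hd : 0 < d ∧ d < n
  · have hk : ((⟨d, hd.2⟩ : Fin n) : ℕ) = (⟨d - 1, by omega⟩ : Fin n) + 1 := by
      simp only
      omega
    have := mem_Des_iff_lt (Tuple.sort f)⁻¹ hk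
    simp only at this
    have hlt : (⟨d - 1, by omega⟩ : Fin n) < ⟨d, hd.2⟩ := Fin.lt_def.2 (by simp only; omega)
    have hne : (Tuple.sort f)⁻¹ ⟨d - 1, by omega⟩ ≠ (Tuple.sort f)⁻¹ ⟨d, hd.2⟩ :=
      fun e => hlt.ne ((Tuple.sort f)⁻¹.injective e)
    rw [this, ← not_iff_not, not_lt, hne.le_iff_lt, h _ _ hlt]
    constructor
    · intro hle hdL
      refine absurd hle (not_le.2 (card_lt_card ?_))
      refine (ssubset_iff_of_subset fun e he => ?_).2 ⟨d, ?_, ?_⟩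
      · simp only [mem_filter] at he ⊢
        exact ⟨he.1, by omega⟩
      · simp only [mem_filter]
        exact ⟨hdL, by omega⟩
      · simp
    · intro hdL
      refine card_le_card fun e he => ?_
      simp only [mem_filter] at he ⊢
      refine ⟨he.1, lt_of_le_of_ne (by omega) ?_⟩
      rintro rfl
      exact hdL he.1
  · constructor
    · intro h
      rw [mem_Des_iff] at h
      omega
    · intro h
      exact absurd (cDes_subset L h) hd

/-- The exponent of the leading monomial `x_0 ^ L₁ * x_1 ^ L₂ * ⋯` of `L`, written as a sum over the
positions: the variable at the position `j` is the number of the part of `L` containing `j`. -/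
def leadExp {n : ℕ} (L : Composition n) : ℕ →₀ ℕ := ∑ j, Finsupp.single (L.index j : ℕ) 1

/-- The leading exponent in terms of the parts of the composition. -/
theorem leadExp_eq {n : ℕ} (L : Composition n) :
    leadExp L = ∑ l : Fin L.length, Finsupp.single (l : ℕ) (L.blocksFun l) := by
  rw [leadExp, ← L.blocksFinEquiv.sum_comp, Fintype.sum_sigma]
  refine sum_congr rfl fun l _ => ?_
  have : ∀ y, L.index (L.blocksFinEquiv ⟨l, y⟩) = l := fun y => L.index_embedding l y
  simp [this]

theorem exists_leadExp_eq {k : ℕ} (a : Fin k → ℕ) (ha : ∀ l, 0 < a l) :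
    ∃ (n : ℕ) (L : Composition n), leadExp L = ∑ l : Fin k, Finsupp.single (l : ℕ) (a l) := by
  let L : Composition (∑ l, a l) :=
    { blocks := List.ofFn a
      blocks_pos := fun {i} hi => by
        obtain ⟨l, rfl⟩ := (List.mem_ofFn' _ _).1 hi
        exact ha l
      blocks_sum := by rw [List.sum_ofFn] }
  have hL : L.length = k := List.length_ofFn
  refine ⟨_, L, ?_⟩
  rw [leadExp_eq]
  refine Fintype.sum_equiv (finCongr hL) _ _ fun l => ?_
  simp [Composition.blocksFun, L]
  rfl

theorem degree_leadExp {n : ℕ} (L : Composition n) : (leadExp L).degree = n := by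
  simp [leadExp]

theorem index_monotone {n : ℕ} (L : Composition n) : Monotone fun j => (L.index j : ℕ) := by
  intro j k hjk
  by_contra hc
  simp only [not_le] at hc
  have h1 := L.sizeUpTo_index_le j
  have h2 : (k : ℕ) < L.sizeUpTo (L.index k + 1) := L.lt_sizeUpTo_index_succ k
  have h3 := L.monotone_sizeUpTo (show (L.index k : ℕ) + 1 ≤ L.index j from hc)
  have := Fin.le_def.1 hjk
  omega

theorem index_lt_iff {n : ℕ} (L : Composition n) {j k : Fin n} (h : (k : ℕ) = j + 1) :
    (L.index j : ℕ) < L.index k ↔ (k : ℕ) ∈ cDes L := by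
  have h1 := L.sizeUpTo_index_le j
  have h2 : (j : ℕ) < L.sizeUpTo (L.index j + 1) := L.lt_sizeUpTo_index_succ j
  have h3 := L.sizeUpTo_index_le k
  have h4 : (k : ℕ) < L.sizeUpTo (L.index k + 1) := L.lt_sizeUpTo_index_succ k
  rw [mem_cDes_iff]
  constructor
  · intro hlt
    have h5 := L.monotone_sizeUpTo (show (L.index j : ℕ) + 1 ≤ L.index k from hlt)
    exact ⟨by omega, k.2, L.index k, (L.index k).2.le, by omega⟩
  · rintro ⟨-, -, l, hl, hk⟩
    by_contra hc
    rcases le_or_gt l (L.index j : ℕ) with h5 | h5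
    · have := L.monotone_sizeUpTo h5
      omega
    · have := L.monotone_sizeUpTo (show (L.index k : ℕ) + 1 ≤ l by omega)
      omega

theorem sum_single_eq_toFinsupp {n : ℕ} (a : Fin n → ℕ) :
    ∑ j, Finsupp.single (a j) 1 = Multiset.toFinsupp (List.ofFn a : Multiset ℕ) := by
  rw [← Fin.univ_val_map, ← Multiset.sum_map_singleton (Multiset.map a univ.val), Multiset.map_map,
    map_multiset_sum, Multiset.map_map]
  simp [Finset.sum]

theorem eq_of_monotone_of_sum_single_eq {n : ℕ} {a b : Fin n → ℕ} (ha : Monotone a)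
    (hb : Monotone b) (h : ∑ j, Finsupp.single (a j) 1 = ∑ j, Finsupp.single (b j) 1) :
    a = b := by
  rw [sum_single_eq_toFinsupp, sum_single_eq_toFinsupp, EmbeddingLike.apply_eq_iff_eq,
    Multiset.coe_eq_coe] at h
  exact List.ofFn_injective (h.eq_of_sortedLE ha.sortedLE_ofFn hb.sortedLE_ofFn)

/-- Triangularity of the fundamental basis: the leading monomial of `L` occurs in `F_K` only if `L`
refines `K`. -/
theorem coeff_leadExp_F {n m : ℕ} (L : Composition n) (K : Composition m)
    (h : MvPowerSeries.coeff (leadExp L) (F K : MvPowerSeries ℕ ℚ) ≠ 0) :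
    m = n ∧ cDes K ⊆ cDes L := by
  change fundamentalSeries K (leadExp L) ≠ 0 at h
  classical
  obtain ⟨⟨i, hi, hd, hs⟩, -⟩ := ite_ne_right_iff.1 h
  have hn := congrArg Finsupp.degree hs
  rw [degree_leadExp] at hn
  simp at hn
  subst hn
  obtain rfl := eq_of_monotone_of_sum_single_eq hi (index_monotone L) hs
  refine ⟨rfl, fun d hdK => ?_⟩
  obtain ⟨h1, h2⟩ := cDes_subset K hdK
  have hk : ((⟨d, h2⟩ : Fin m) : ℕ) = (⟨d - 1, by omega⟩ : Fin m) + 1 := by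
    simp only
    omega
  exact (index_lt_iff L hk).1 (hd _ _ hk hdK)

theorem coeff_leadExp_F_self {n : ℕ} (L : Composition n) :
    MvPowerSeries.coeff (leadExp L) (F L : MvPowerSeries ℕ ℚ) = 1 :=
  if_pos ⟨fun j => (L.index j : ℕ), index_monotone L, fun _ _ hk hd => (index_lt_iff L hk).2 hd,
    rfl⟩

/-- The coefficient of the leading monomial of `L`, as a linear functional. -/
def leadCoeff (L : Σ n, Composition n) : QSym →ₗ[ℚ] ℚ :=
  MvPowerSeries.coeff (leadExp L.2) ∘ₗ QSym.val.toLinearMap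

theorem leadCoeff_F_self (L : Σ n, Composition n) : leadCoeff L (F L.2) = 1 :=
  coeff_leadExp_F_self L.2

theorem leadCoeff_F (L K : Σ n, Composition n) (hne : K ≠ L)
    (h : (cDes L.2).card ≤ (cDes K.2).card) :
    leadCoeff L (F K.2) = 0 := by
  by_contra hc
  obtain ⟨n, L⟩ := L
  obtain ⟨m, K⟩ := K
  obtain ⟨rfl, hs⟩ := coeff_leadExp_F L K hc
  exact hne (by rw [cDes_injective (eq_of_subset_of_card_le hs h)])

theorem linearIndependent_F : LinearIndependent ℚ fun L : Σ n, Composition n => F L.2 :=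
  linearIndependent_of_triangular _ (fun L => (cDes L.2).card) leadCoeff
    (fun L => by rw [leadCoeff_F_self]; exact one_ne_zero) leadCoeff_F

/-- A quasisymmetric function is determined by the coefficients of the leading monomials. -/
theorem eq_zero_of_leadCoeff (f : QSym) (h : ∀ L, leadCoeff L f = 0) : f = 0 := by
  apply Subtype.ext
  ext e
  let i := e.support.orderEmbOfFin rfl
  have he : e = ∑ l, Finsupp.single (i l) (e (i l)) := by
    conv_lhs => rw [← Finsupp.sum_single e]
    rw [Finsupp.sum]
    conv_lhs => rw [← Finset.image_orderEmbOfFin_univ e.support rfl]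
    rw [sum_image fun _ _ _ _ h => i.injective h]
  have hpos : ∀ l, 0 < e (i l) := fun l =>
    Nat.pos_of_ne_zero (Finsupp.mem_support_iff.1 (Finset.orderEmbOfFin_mem _ _ _))
  obtain ⟨n, L, hL⟩ := exists_leadExp_eq _ hpos
  rw [he, f.2.2 _ _ hpos i (fun l : Fin _ => (l : ℕ)) i.strictMono Fin.val_strictMono, ← hL]
  exact h ⟨n, L⟩

/-- In degrees at most `d`, a quasisymmetric function is determined by finitely many coefficients,
and there are as many, linearly independent, `F_L`. -/
theorem span_F : Submodule.span ℚ (Set.range fun L : Σ n, Composition n => F L.2) = ⊤ := by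
  rw [Submodule.eq_top_iff']
  intro f
  obtain ⟨d, hd⟩ := f.2.1
  -- The coefficients of the leading monomials of degree at most `d`.
  let ι := Σ n : Fin (d + 1), Composition (n : ℕ)
  let toS : ι → Σ n, Composition n := fun L => ⟨L.1, L.2⟩
  have htoS : Function.Injective toS := by
    rintro ⟨⟨n, hn⟩, L⟩ ⟨⟨m, hm⟩, K⟩ h
    obtain ⟨h1, h2⟩ := Sigma.mk.inj h
    simp only at h1
    subst h1
    exact Sigma.ext rfl h2
  let C : QSym →ₗ[ℚ] ι → ℚ := LinearMap.pi fun L => leadCoeff (toS L)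
  have hli : LinearIndependent ℚ fun L : ι => C (F L.2) :=
    linearIndependent_of_triangular _ (fun L => (cDes L.2).card) (fun L => LinearMap.proj L)
      (fun L => by
        change leadCoeff (toS L) (F (toS L).2) ≠ 0
        rw [leadCoeff_F_self]
        exact one_ne_zero)
      (fun L K hKL h => leadCoeff_F (toS L) (toS K) (fun e => hKL (htoS e)) h)
  have hsp := hli.span_eq_top_of_card_eq_finrank' (by simp)
  obtain ⟨g, hg⟩ := (Submodule.mem_span_range_iff_exists_fun ℚ).1
    (hsp ▸ Submodule.mem_top : C f ∈ Submodule.span ℚ (Set.range fun L : ι => C (F L.2)))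
  have hf : f - ∑ L : ι, g L • F L.2 = 0 := by
    apply eq_zero_of_leadCoeff
    rintro ⟨n, L⟩
    by_cases hn : n ≤ d
    · have := congrFun (show C (f - ∑ L : ι, g L • F L.2) = 0 by
        rw [map_sub, map_sum, ← hg]
        simp) ⟨⟨n, Nat.lt_succ_iff.2 hn⟩, L⟩
      exact this
    · rw [map_sub, map_sum, sum_eq_zero, sub_zero]
      · exact hd _ ((not_le.1 hn).trans_eq (degree_leadExp L).symm)
      · intro K _
        rw [map_smul]
        by_contra hc
        obtain ⟨h1, -⟩ := coeff_leadExp_F L K.2 (right_ne_zero_of_mul hc)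
        have h2 : (K.1 : ℕ) = n := h1
        have := K.1.2
        omega
  rw [sub_eq_zero.1 hf]
  exact Submodule.sum_mem _ fun L _ => Submodule.smul_mem _ _ (Submodule.subset_span ⟨toS L, rfl⟩)

/-- The basis of the fundamental quasisymmetric functions. -/
def basisF : Module.Basis (Σ n, Composition n) ℚ QSym :=
  Module.Basis.mk linearIndependent_F span_F.ge

theorem basisF_apply (L : Σ n, Composition n) : basisF L = F L.2 := Module.Basis.mk_apply _ _ _

/-! ### The commutative image of `FQSym` -/

/-- The finite set of words whose letters, in commuting variables, make up the monomial of
exponent `e`. -/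
def wordsOf (e : ℕ →₀ ℕ) : Finset (List ℕ) := (Finsupp.toMultiset e).lists.toFinset

theorem mem_wordsOf {e : ℕ →₀ ℕ} {w : List ℕ} :
    w ∈ wordsOf e ↔ Finsupp.toMultiset e = (w : Multiset ℕ) := by
  rw [wordsOf, Multiset.mem_toFinset, Multiset.mem_lists_iff]
  rfl

/-- The commutative image of a series in noncommuting variables: the coefficient of a monomial is
the sum of the coefficients of the finitely many words with this content. -/
def commImage : TotalAlgebra →ₗ[ℚ] MvPowerSeries ℕ ℚ where
  toFun f := fun e => ∑ w ∈ wordsOf e, f w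
  map_add' f g := by
    ext e
    exact sum_add_distrib
  map_smul' c f := by
    ext e
    exact (mul_sum _ _ _).symm

theorem coeff_commImage (f : TotalAlgebra) (e : ℕ →₀ ℕ) :
    MvPowerSeries.coeff e (commImage f) = ∑ w ∈ wordsOf e, f w := rfl

/-- A factorization of a word is determined by its two factors. -/
theorem sum_factorizations (f g : List ℕ → ℚ) (e : ℕ →₀ ℕ) :
    ∑ w ∈ wordsOf e, ∑ i ∈ range (w.length + 1), f (w.take i) * g (w.drop i) =
      ∑ p ∈ HasAntidiagonal.antidiagonal e, (∑ u ∈ wordsOf p.1, f u) * ∑ v ∈ wordsOf p.2, g v := by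
  simp only [sum_mul_sum]
  simp only [← sum_product']
  rw [sum_sigma', sum_sigma']
  refine sum_bij' (fun p _ => ⟨(Multiset.toFinsupp (p.1.take p.2 : Multiset ℕ),
      Multiset.toFinsupp (p.1.drop p.2 : Multiset ℕ)), (p.1.take p.2, p.1.drop p.2)⟩)
    (fun p _ => ⟨p.2.1 ++ p.2.2, p.2.1.length⟩) ?_ ?_ ?_ ?_ ?_
  · rintro ⟨w, i⟩ h
    simp only [mem_sigma, mem_wordsOf, mem_range, HasAntidiagonal.mem_antidiagonal,
      mem_product] at h ⊢
    refine ⟨?_, by simp, by simp⟩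
    rw [← map_add, Multiset.coe_add, List.take_append_drop]
    exact (Finsupp.toMultiset_eq_iff.1 h.1).symm
  · rintro ⟨⟨e1, e2⟩, u, v⟩ h
    simp only [mem_sigma, mem_wordsOf, mem_range, HasAntidiagonal.mem_antidiagonal,
      mem_product] at h ⊢
    refine ⟨?_, by simp⟩
    rw [← h.1, map_add, h.2.1, h.2.2]
    rfl
  · rintro ⟨w, i⟩ h
    simp only [mem_sigma, mem_range] at h
    simp
    omega
  · rintro ⟨⟨e1, e2⟩, u, v⟩ h
    simp only [mem_sigma, mem_wordsOf, HasAntidiagonal.mem_antidiagonal,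
      mem_product] at h
    have h1 : Multiset.toFinsupp (u : Multiset ℕ) = e1 := by
      rw [← Finsupp.toMultiset_toFinsupp e1, h.2.1]
    have h2 : Multiset.toFinsupp (v : Multiset ℕ) = e2 := by
      rw [← Finsupp.toMultiset_toFinsupp e2, h.2.2]
    simp [h1, h2]
  · rintro ⟨w, i⟩ h
    rfl

theorem commImage_mul (f g : TotalAlgebra) : commImage (f * g) = commImage f * commImage g := by
  ext e
  rw [MvPowerSeries.coeff_mul]
  exact sum_factorizations f g e

theorem signedAdmissible_true_iff (D : Finset ℕ) {n : ℕ} (a : Fin n → ℕ) :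
    SignedAdmissible (fun _ => True) D a ↔ Monotone a ∧
      ∀ j k : Fin n, (k : ℕ) = j + 1 → (k : ℕ) ∈ D → a j < a k := by
  constructor
  · intro h
    refine ⟨h.monotone, fun j k hk hD => ?_⟩
    have := h j k hk
    simpa [SignedStep, hD] using this
  · rintro ⟨hm, hs⟩ j k hk
    by_cases hD : (k : ℕ) ∈ D
    · exact Or.inl (hs j k hk hD)
    · rcases (hm (Fin.le_def.2 (by omega) : j ≤ k)).lt_or_eq with h | h
      · exact Or.inl h
      · exact Or.inr ⟨h, by simp [hD]⟩

theorem std_ofFn {n : ℕ} (w : Fin n → ℕ) (π : Equiv.Perm (Fin n)) :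
    std (List.ofFn w) = ⟨n, π⟩ ↔ Monotone (w ∘ ⇑π⁻¹) ∧
      ∀ j k : Fin n, (k : ℕ) = j + 1 → (k : ℕ) ∈ Des π⁻¹ → w (π⁻¹ j) < w (π⁻¹ k) := by
  have : std (List.ofFn w) = std (unsign (fun _ => True) (List.ofFn w)) := by
    rw [std_congr_iff]
    refine ⟨by rw [length_unsign], fun i j hij hj => ?_⟩
    rw [unsign_le_iff _ _ hij hj, and_true, le_iff_lt_or_eq]
  rw [this, std_unsign_ofFn, signedAdmissible_true_iff]
  rfl

theorem sum_single_comp_perm {n : ℕ} (w : Fin n → ℕ) (σ : Equiv.Perm (Fin n)) :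
    ∑ j, Finsupp.single (w (σ j)) 1 = ∑ j, Finsupp.single (w j) 1 :=
  Equiv.sum_comp σ fun j => Finsupp.single (w j) 1

/-- The words standardizing to `π` are, up to the order of their letters, the sequences enumerated
by the fundamental quasisymmetric function of `π⁻¹`; so `ρ` is the passage to commuting
variables. -/
theorem commImage_G {n : ℕ} (π : Equiv.Perm (Fin n)) :
    commImage (G ⟨n, π⟩) = (F (Comp π⁻¹) : MvPowerSeries ℕ ℚ) := by
  classical
  ext e
  rw [coeff_commImage]
  change _ = fundamentalSeries (Comp π⁻¹) e
  simp only [G, fundamentalSeries, cDes_Comp]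
  rw [sum_ite, sum_const_zero, add_zero, sum_const, nsmul_eq_mul, mul_one]
  have hlen : ∀ w, std w = ⟨n, π⟩ → ∃ a : Fin n → ℕ, w = List.ofFn a := fun w hw => by
    have : w.length = n := congrArg Sigma.fst hw
    subst this
    exact ⟨w.get, (List.ofFn_get w).symm⟩
  -- A word is determined by its content and its standardization.
  have huniq : #{w ∈ wordsOf e | std w = ⟨n, π⟩} ≤ 1 := by
    refine card_le_one.2 fun u hu v hv => ?_
    simp only [mem_filter, mem_wordsOf] at hu hv
    obtain ⟨a, rfl⟩ := hlen u hu.2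
    obtain ⟨b, rfl⟩ := hlen v hv.2
    have ha := ((std_ofFn a π).1 hu.2).1
    have hb := ((std_ofFn b π).1 hv.2).1
    have := eq_of_monotone_of_sum_single_eq ha hb (by
      simp only [Function.comp]
      rw [sum_single_comp_perm, sum_single_comp_perm, sum_single_eq_toFinsupp,
        sum_single_eq_toFinsupp]
      exact congrArg Multiset.toFinsupp (hu.1.symm.trans hv.1))
    rw [show a = b from funext fun i => by simpa using congrFun this (π i)]
  split_ifs with h
  · obtain ⟨i, hm, hs, rfl⟩ := h
    rw [le_antisymm huniq, Nat.cast_one]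
    refine card_pos.2 ⟨List.ofFn (i ∘ ⇑π), ?_⟩
    rw [mem_filter, std_ofFn, mem_wordsOf]
    refine ⟨?_, by convert hm using 1; ext; simp, fun j k hk hD => by simpa using hs j k hk hD⟩
    rw [← sum_single_comp_perm i π]
    exact (congrArg Finsupp.toMultiset (sum_single_eq_toFinsupp (i ∘ ⇑π))).trans
      (Multiset.toFinsupp_toMultiset _)
  · rw [Nat.cast_eq_zero, card_eq_zero, filter_eq_empty_iff]
    intro w hw hstd
    obtain ⟨a, rfl⟩ := hlen w hstd
    rw [mem_wordsOf] at hw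
    rw [std_ofFn] at hstd
    refine h ⟨_, hstd.1, hstd.2, ?_⟩
    simp only [Function.comp]
    rw [sum_single_comp_perm, sum_single_eq_toFinsupp, ← Finsupp.toMultiset_toFinsupp e, hw]

theorem rho_basisG {n : ℕ} (π : Equiv.Perm (Fin n)) : rho (basisG ⟨n, π⟩) = F (Comp π⁻¹) :=
  Module.Basis.constr_basis _ _ _ _

theorem coe_rho (f : FQSym) : (rho f : MvPowerSeries ℕ ℚ) = commImage f := by
  have : QSym.val.toLinearMap ∘ₗ rho = commImage ∘ₗ FQSym.val.toLinearMap :=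
    basisG.ext fun π => by
      obtain ⟨n, π⟩ := π
      change (rho (basisG ⟨n, π⟩) : MvPowerSeries ℕ ℚ) = commImage (basisG ⟨n, π⟩ : FQSym)
      rw [rho_basisG, coe_basisG, commImage_G]
  exact LinearMap.congr_fun this f

/-- The map `ρ` as a homomorphism of algebras. -/
def rhoHom : FQSym →ₐ[ℚ] QSym :=
  AlgHom.ofLinearMap rho
    (Subtype.ext (by
      rw [coe_rho]
      ext e
      rw [coeff_commImage]
      change _ = MvPowerSeries.coeff e 1
      rw [MvPowerSeries.coeff_one]
      simp only [OneMemClass.coe_one, TotalAlgebra.one_apply]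
      rw [sum_ite_eq']
      refine if_congr ?_ rfl rfl
      rw [mem_wordsOf]
      rw [Finsupp.toMultiset_eq_iff]
      exact Iff.of_eq (congrArg _ (map_zero _))))
    (fun f g => Subtype.ext (by
      rw [coe_rho, MulMemClass.coe_mul, commImage_mul, MulMemClass.coe_mul, coe_rho, coe_rho]))

theorem rhoHom_basisG {n : ℕ} (π : Equiv.Perm (Fin n)) :
    rhoHom (basisG ⟨n, π⟩) = F (Comp π⁻¹) := rho_basisG π

theorem rhoHom_surjective : Function.Surjective rhoHom := by
  have : LinearMap.range rho = ⊤ := by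
    rw [eq_top_iff, ← span_F, Submodule.span_le]
    rintro _ ⟨⟨n, L⟩, rfl⟩
    obtain ⟨π, rfl⟩ := exists_Comp_eq L
    exact ⟨basisG ⟨n, π⁻¹⟩, by rw [rho_basisG, inv_inv]⟩
  exact LinearMap.range_eq_top.1 this

/-! ### Recursion for the enumerators -/

section

variable {R : Type*} [CommRing R] (wt : ℕ → R) (m : ℕ) (s : ℕ → Prop) (D : Finset ℕ)

theorem enum_zero : enum wt m s D 0 = 1 := by
  classical
  rw [enum, filter_true_of_mem]
  · simp
  · exact fun a _ j => j.elim0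

theorem enum_zero_letters (n : ℕ) : enum wt 0 s D (n + 1) = 0 := by
  simp [enum]

theorem signedAdmissible_snoc_iff {n : ℕ} (b : Fin n → ℕ) (c : ℕ) :
    SignedAdmissible s D (Fin.snoc b c : Fin (n + 1) → ℕ) ↔
      SignedAdmissible s D b ∧ ∀ j : Fin n, (j : ℕ) + 1 = n → SignedStep s D n (b j) c := by
  constructor
  · intro h
    refine ⟨fun j k hk => ?_, fun j hj => ?_⟩
    · simpa using h j.castSucc k.castSucc (by simpa using hk)
    · simpa using h j.castSucc (Fin.last n) (by simpa using hj.symm)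
  · rintro ⟨h1, h2⟩ j k hk
    have hj : (j : ℕ) < n := by omega
    obtain ⟨j, rfl⟩ : ∃ j' : Fin n, j = j'.castSucc := ⟨⟨j, hj⟩, rfl⟩
    refine Fin.lastCases (fun hk => ?_) (fun k hk => ?_) k hk
    · simpa using h2 j (by simpa using hk.symm)
    · simpa using h1 j k (by simpa using hk)

/-- The admissible sequences whose last letter is the largest letter `m`: the preceding letters are
`m` or smaller, respectively smaller than `m`, if `m` can or cannot be repeated at that point. -/
theorem admissible_snoc_max_iff {n : ℕ} [Decidable (s m ↔ n ∉ D)] (b : Fin n → ℕ) :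
    ((∀ i, b i < m + 1) ∧ SignedAdmissible s D (Fin.snoc b m : Fin (n + 1) → ℕ)) ↔
      (∀ i, b i < if (s m ↔ n ∉ D) then m + 1 else m) ∧ SignedAdmissible s D b := by
  rw [signedAdmissible_snoc_iff]
  constructor
  · rintro ⟨h1, h2, h3⟩
    refine ⟨fun i => ?_, h2⟩
    split_ifs with h
    · exact h1 i
    · obtain ⟨l, rfl⟩ : ∃ l, n = l + 1 := ⟨n - 1, by have := i.2; omega⟩
      have hl := h3 (Fin.last l) rfl
      have hi := h2.monotone (Fin.le_last i)
      rcases hl with hl | hl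
      · omega
      · rw [hl.1] at hl
        exact absurd hl.2 h
  · rintro ⟨h1, h2⟩
    refine ⟨fun i => (h1 i).trans_le (by split_ifs <;> omega), h2, fun j _ => ?_⟩
    have := h1 j
    split_ifs at this with h
    · rcases (Nat.lt_succ_iff.1 this).lt_or_eq with hj | hj
      · exact Or.inl hj
      · exact Or.inr ⟨hj, hj.symm ▸ h⟩
    · exact Or.inl this

/-- The recursion according to whether the largest letter `m` is the last letter of the sequence. -/
theorem enum_succ [DecidablePred s] (n : ℕ) : enum wt (m + 1) s D (n + 1) = enum wt m s D (n + 1) +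
    wt m * enum wt (if (s m ↔ n ∉ D) then m + 1 else m) s D n := by
  classical
  rw [enum, ← sum_filter_add_sum_filter_not _ fun a => a (Fin.last n) < m]
  congr 1
  · rw [enum]
    refine sum_congr ?_ fun _ _ => rfl
    ext a
    simp only [mem_filter, Fintype.mem_piFinset, mem_range]
    constructor
    · rintro ⟨⟨-, h2⟩, h3⟩
      exact ⟨fun i => (h2.monotone (Fin.le_last i)).trans_lt h3, h2⟩
    · rintro ⟨h1, h2⟩
      exact ⟨⟨fun i => (h1 i).trans (Nat.lt_succ_self m), h2⟩, h1 _⟩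
  · rw [enum, mul_sum]
    have hlast : ∀ a : Fin (n + 1) → ℕ, (∀ i, a i < m + 1) → ¬ a (Fin.last n) < m →
        (Fin.snoc (Fin.init a) m : Fin (n + 1) → ℕ) = a := by
      intro a h1 h2
      have : a (Fin.last n) = m := by
        have := h1 (Fin.last n)
        omega
      rw [← this]
      exact Fin.snoc_init_self a
    refine sum_bij' (fun a _ => Fin.init a) (fun b _ => (Fin.snoc b m : Fin (n + 1) → ℕ))
      ?_ ?_ ?_ ?_ ?_
    · intro a ha
      simp only [mem_filter, Fintype.mem_piFinset, mem_range] at ha ⊢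
      rw [← admissible_snoc_max_iff, hlast a ha.1.1 ha.2]
      exact ⟨fun i => ha.1.1 i.castSucc, ha.1.2⟩
    · intro b hb
      simp only [mem_filter, Fintype.mem_piFinset, mem_range] at hb ⊢
      rw [← admissible_snoc_max_iff] at hb
      refine ⟨⟨fun i => ?_, hb.2⟩, by simp⟩
      refine Fin.lastCases ?_ (fun i => ?_) i
      · simp
      · simpa using hb.1 i
    · intro a ha
      simp only [mem_filter, Fintype.mem_piFinset, mem_range] at ha
      exact hlast a ha.1.1 ha.2
    · intro b _
      exact Fin.init_snoc (α := fun _ => ℕ) m b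
    · intro a ha
      simp only [mem_filter, Fintype.mem_piFinset, mem_range] at ha
      rw [← hlast a ha.1.1 ha.2, Fin.prod_univ_castSucc, mul_comm]
      simp

end

/-! ### The generating function of descents and comajor index -/

theorem coeff_zero_one_sub_X_mul {R : Type*} [CommRing R] (f : PowerSeries R) :
    PowerSeries.coeff 0 ((1 - PowerSeries.X) * f) = PowerSeries.coeff 0 f := by
  simp [sub_mul]

theorem coeff_succ_one_sub_X_mul {R : Type*} [CommRing R] (f : PowerSeries R) (k : ℕ) :
    PowerSeries.coeff (k + 1) ((1 - PowerSeries.X) * f) =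
      PowerSeries.coeff (k + 1) f - PowerSeries.coeff k f := by
  simp [sub_mul, PowerSeries.coeff_succ_X_mul]

/-- The weight `q ^ i` of the letter `i`. -/
def qWeight (i : ℕ) : PowerSeries ℚ := PowerSeries.X ^ i

/-- The series in `t` whose coefficient of `t ^ m` is the enumerator, with the weights `q ^ i`, of
the admissible sequences in the positive letters `0, …, m`. The alphabet has `m + 1` letters, so
that for `n ≥ 1` this is the generating function by the number of letters, divided by `t`. -/
def qEnumSeries (D : Finset ℕ) (n : ℕ) : PowerSeries (PowerSeries ℚ) :=
  PowerSeries.mk fun m => enum qWeight (m + 1) (fun _ => True) D n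

open PowerSeries in
theorem qEnumSeries_succ_of_notMem {D : Finset ℕ} {n : ℕ} (hn : n ∉ D) :
    (1 - X) * qEnumSeries D (n + 1) = rescale X (qEnumSeries D n) := by
  ext1 k
  cases k with
  | zero =>
    rw [coeff_zero_one_sub_X_mul]
    simp [qEnumSeries, enum_succ, enum_zero_letters, hn, qWeight, coeff_rescale]
  | succ k =>
    rw [coeff_succ_one_sub_X_mul, coeff_rescale]
    simp [qEnumSeries, enum_succ _ (k + 1), hn, qWeight]

open PowerSeries in
theorem qEnumSeries_succ_of_mem {D : Finset ℕ} {n : ℕ} (h0 : 0 ∉ D) (hn : n ∈ D) :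
    (1 - X) * qEnumSeries D (n + 1) = rescale X (X * qEnumSeries D n) := by
  obtain ⟨l, rfl⟩ : ∃ l, n = l + 1 := Nat.exists_eq_succ_of_ne_zero fun h => h0 (h ▸ hn)
  ext1 k
  cases k with
  | zero =>
    rw [coeff_zero_one_sub_X_mul]
    simp [qEnumSeries, enum_succ _ 0 _ _ (l + 1), enum_zero_letters, hn]
  | succ k =>
    rw [coeff_succ_one_sub_X_mul, coeff_rescale, coeff_succ_X_mul]
    simp [qEnumSeries, enum_succ _ (k + 1) _ _ (l + 1), hn, qWeight]

open PowerSeries in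
/-- The generating function of the sequences with descent set `D`, in terms of the number of
descents and the comajor index. One more letter amounts to the substitution `t ↦ q t`, which shifts
the factors `1 - t q ^ i` and multiplies `t ^ d` by the increase `q ^ d` of the comajor index. -/
theorem qEnumSeries_mul {D : Finset ℕ} (h0 : 0 ∉ D) (n : ℕ) :
    qEnumSeries D n * ∏ i ∈ range (n + 1), (1 - X * C X ^ i) =
      X ^ #{i ∈ range n | i ∈ D} * C X ^ (∑ i ∈ range n with i ∈ D, (n - i)) := by
  induction n with
  | zero =>
    have : qEnumSeries D 0 = PowerSeries.mk 1 := by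
      ext1 k
      simp [qEnumSeries, enum_zero]
    rw [this]
    simpa using mk_one_mul_one_sub_eq_one (PowerSeries ℚ)
  | succ n ih =>
    have hc : ∑ i ∈ range n with i ∈ D, (n + 1 - i) =
        ∑ i ∈ range n with i ∈ D, (n - i) + #{i ∈ range n | i ∈ D} := by
      rw [card_eq_sum_ones, ← sum_add_distrib]
      refine sum_congr rfl fun i hi => ?_
      simp only [mem_filter, mem_range] at hi
      omega
    have hC : rescale (X : PowerSeries ℚ) (C X) = C X := by
      ext1 k
      cases k <;> simp [coeff_rescale, coeff_C]
    have hres := congrArg (rescale (X : PowerSeries ℚ)) ih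
    simp only [map_mul, map_prod, map_pow, map_sub, map_one, rescale_X, hC] at hres
    have hprod : ∏ i ∈ range (n + 1), (1 - X * C X ^ (i + 1)) =
        ∏ i ∈ range (n + 1), (1 - C (X : PowerSeries ℚ) * X * C X ^ i) :=
      prod_congr rfl fun i _ => by ring
    rw [prod_range_succ', hprod, pow_zero, mul_one, mul_comm _ (1 - X), ← mul_assoc,
      mul_comm _ (1 - X)]
    generalize ∏ i ∈ range (n + 1), (1 - C (X : PowerSeries ℚ) * X * C X ^ i) = P at hres ⊢
    rw [range_add_one, filter_insert]
    split_ifs with hn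
    · rw [qEnumSeries_succ_of_mem h0 hn, card_insert_of_notMem (by simp),
        sum_insert (by simp), hc, map_mul, rescale_X, mul_assoc, hres]
      simp only [Nat.add_sub_cancel_left]
      ring
    · rw [qEnumSeries_succ_of_notMem hn, hc, hres]
      ring

/-! ### The generating functions of peaks and left peaks -/

section

variable (T : ℕ → Prop) [DecidablePred T]

/-- The number of `i` with `1 ≤ i < n` such that `T i` holds and `T (i - 1)` does not. -/
def numUp (n : ℕ) : ℕ := #{i ∈ range n | 1 ≤ i ∧ T i ∧ ¬ T (i - 1)}

/-- The number of `i` with `1 ≤ i < n` such that `T (i - 1)` holds and `T i` does not. -/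
def numDown (n : ℕ) : ℕ := #{i ∈ range n | 1 ≤ i ∧ ¬ T i ∧ T (i - 1)}

theorem numUp_succ (n : ℕ) :
    numUp T (n + 2) = numUp T (n + 1) + if T (n + 1) ∧ ¬ T n then 1 else 0 := by
  rw [numUp, numUp, range_add_one (n := n + 1), filter_insert]
  simp only [le_add_iff_nonneg_left, zero_le, true_and, Nat.add_sub_cancel]
  split_ifs with h
  · rw [card_insert_of_notMem (by simp)]
  · rfl

theorem numDown_succ (n : ℕ) :
    numDown T (n + 2) = numDown T (n + 1) + if ¬ T (n + 1) ∧ T n then 1 else 0 := by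
  rw [numDown, numDown, range_add_one (n := n + 1), filter_insert]
  simp only [le_add_iff_nonneg_left, zero_le, true_and, Nat.add_sub_cancel]
  split_ifs with h
  · rw [card_insert_of_notMem (by simp)]
  · rfl

/-- The changes of the truth values `T 0, …, T n` alternate in direction; the first one is from true
to false. -/
theorem numDown_eq (h0 : T 0) (n : ℕ) :
    numDown T (n + 1) = numUp T (n + 1) + if T n then 0 else 1 := by
  induction n with
  | zero => simp [numDown, numUp, h0, filter_singleton]
  | succ n ih =>
    rw [numUp_succ, numDown_succ, ih]
    by_cases h1 : T n <;> by_cases h2 : T (n + 1) <;> simp [h1, h2]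

theorem two_mul_numUp_le (h0 : T 0) (n : ℕ) :
    2 * numUp T (n + 1) + (if T n then 0 else 1) ≤ n := by
  induction n with
  | zero => simp [numUp, h0, filter_singleton]
  | succ n ih =>
    rw [numUp_succ]
    by_cases h1 : T n <;> by_cases h2 : T (n + 1) <;> simp [h1, h2] at ih ⊢ <;> omega

variable {T} {N : ℕ → ℕ → ℚ}

open PowerSeries in
/-- The generating functions of `N n` at even and at odd arguments, where `N` is given by the
recursion for the enumerators over an alphabet with alternating signs; `T n` says that the letters
with even number are the ones that can be repeated at the positions `n, n + 1`. -/
theorem alternating_series (h0 : T 0) (hN0 : ∀ m, N 0 m = 1) (hN : ∀ n, N (n + 1) 0 = 0)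
    (hrec : ∀ n m, N (n + 1) (m + 1) = N (n + 1) m + N n (if (Even m ↔ T n) then m + 1 else m))
    (n : ℕ) :
    (1 - X) ^ (n + 2) * (PowerSeries.mk fun k => N (n + 1) (2 * k)) =
        2 ^ (2 * numUp T (n + 1) + 1) * X ^ (numUp T (n + 1) + 1) *
          (1 + X) ^ (n + 1 - 2 * numUp T (n + 1) - 1) ∧
      (1 - X) ^ (n + 2) * (PowerSeries.mk fun k => N (n + 1) (2 * k + 1)) =
        2 ^ (2 * numDown T (n + 1)) * X ^ numDown T (n + 1) *
          (1 + X) ^ (n + 1 - 2 * numDown T (n + 1)) := by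
  have hev : ∀ n k, N (n + 1) (2 * k + 1) = N (n + 1) (2 * k) +
      N n (if T n then 2 * k + 1 else 2 * k) := fun n k => by rw [hrec]; simp
  have hodd : ∀ n k, N (n + 1) (2 * (k + 1)) = N (n + 1) (2 * k + 1) +
      N n (if T n then 2 * k + 1 else 2 * (k + 1)) := fun n k => by
    rw [show 2 * (k + 1) = 2 * k + 1 + 1 by ring, hrec]
    have : ¬ Even (2 * k + 1) := by simp
    by_cases hT : T n <;> simp [hT]
  -- The effect of one more letter on the two generating functions.
  have hT1 : ∀ n, T n →
      (1 - X) * (PowerSeries.mk fun k => N (n + 1) (2 * k)) =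
        2 * X * (PowerSeries.mk fun k => N n (2 * k + 1)) ∧
      (1 - X) * (PowerSeries.mk fun k => N (n + 1) (2 * k + 1)) =
        (1 + X) * (PowerSeries.mk fun k => N n (2 * k + 1)) := by
    intro n hT
    constructor
    · ext1 k
      rw [mul_assoc, two_mul]
      cases k with
      | zero =>
        rw [coeff_zero_one_sub_X_mul]
        simp [hN]
      | succ k =>
        rw [coeff_succ_one_sub_X_mul, map_add, coeff_succ_X_mul]
        simp only [coeff_mk, hodd, hev, hT, if_true]
        ring
    · ext1 k
      rw [add_mul, one_mul]
      cases k with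
      | zero =>
        rw [coeff_zero_one_sub_X_mul, map_add]
        simp [hev n 0, hN, hT]
      | succ k =>
        rw [coeff_succ_one_sub_X_mul, map_add, coeff_succ_X_mul]
        simp only [coeff_mk, hodd, hev n, hT, if_true]
        ring
  have hT0 : ∀ n, ¬ T (n + 1) →
      (1 - X) * (PowerSeries.mk fun k => N (n + 2) (2 * k)) =
        (1 + X) * (PowerSeries.mk fun k => N (n + 1) (2 * k)) ∧
      (1 - X) * (PowerSeries.mk fun k => N (n + 2) (2 * k + 1)) =
        2 * (PowerSeries.mk fun k => N (n + 1) (2 * k)) := by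
    intro n hT
    constructor
    · ext1 k
      rw [add_mul, one_mul]
      cases k with
      | zero =>
        rw [coeff_zero_one_sub_X_mul, map_add]
        simp [hN]
      | succ k =>
        rw [coeff_succ_one_sub_X_mul, map_add, coeff_succ_X_mul]
        simp only [coeff_mk, hodd (n + 1), hev (n + 1), hT, if_false]
        ring
    · ext1 k
      rw [two_mul]
      cases k with
      | zero =>
        rw [coeff_zero_one_sub_X_mul, map_add]
        simp [hev (n + 1) 0, hN, hT]
      | succ k =>
        rw [coeff_succ_one_sub_X_mul, map_add]
        simp only [coeff_mk, hodd (n + 1), hev (n + 1), hT, if_false]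
        ring
  induction n with
  | zero =>
    obtain ⟨h1, h2⟩ := hT1 0 h0
    have h3 : (1 - X) * (PowerSeries.mk fun k => N 0 (2 * k + 1)) = 1 := by
      simp only [hN0]
      rw [mul_comm]
      exact mk_one_mul_one_sub_eq_one ℚ
    have hu : numUp T 1 = 0 := by simp [numUp, filter_singleton]
    have hd : numDown T 1 = 0 := by simp [numDown, filter_singleton]
    simp only [zero_add, hu, hd]
    constructor
    · linear_combination (1 - X) * h1 + 2 * X * h3
    · linear_combination (1 - X) * h2 + (1 + X) * h3
  | succ n ih =>
    obtain ⟨ihE, ihO⟩ := ih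
    have hle := two_mul_numUp_le T h0 n
    have hdu := numDown_eq T h0 n
    have hu' := numUp_succ T n
    have hd' := numDown_succ T n
    by_cases hT : T (n + 1)
    · obtain ⟨h1, h2⟩ := hT1 (n + 1) hT
      have hd : numDown T (n + 2) = numDown T (n + 1) := by simp [hd', hT]
      have hud : numUp T (n + 2) = numDown T (n + 1) := by
        rw [hu', hdu]
        by_cases hTn : T n <;> simp [hT, hTn]
      have hbound : 2 * numDown T (n + 1) ≤ n + 1 := by split_ifs at hle hdu <;> omega
      rw [hd, hud]
      generalize numDown T (n + 1) = d at *
      constructor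
      · rw [show n + 1 + 1 - 2 * d - 1 = n + 1 - 2 * d by omega]
        linear_combination (1 - X) ^ (n + 2) * h1 + 2 * X * ihO
      · rw [show n + 1 + 1 - 2 * d = n + 1 - 2 * d + 1 by omega]
        linear_combination (1 - X) ^ (n + 2) * h2 + (1 + X) * ihO
    · obtain ⟨h1, h2⟩ := hT0 n hT
      have hu : numUp T (n + 2) = numUp T (n + 1) := by simp [hu', hT]
      have hdd : numDown T (n + 2) = numUp T (n + 1) + 1 := by
        rw [hd', hdu]
        by_cases hTn : T n <;> simp [hT, hTn]
      have hbound : 2 * numUp T (n + 1) ≤ n := by omega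
      rw [hu, hdd]
      generalize numUp T (n + 1) = u at *
      constructor
      · rw [show n + 1 + 1 - 2 * u - 1 = n + 1 - 2 * u - 1 + 1 by omega]
        linear_combination (1 - X) ^ (n + 2) * h1 + (1 + X) * ihE
      · rw [show n + 1 + 1 - 2 * (u + 1) = n + 1 - 2 * u - 1 by omega]
        linear_combination (1 - X) ^ (n + 2) * h2 + 2 * ihE

end

/-! ### Homomorphisms to Hadamard algebras -/

namespace HadamardSeries

variable {R : Type*} [CommRing R] [Algebra ℚ R]

/-- The coefficient of `t ^ k`; this is a homomorphism for the Hadamard product. -/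
def coeffT (k : ℕ) : HadamardSeries R →ₐ[ℚ] R := Pi.evalAlgHom ℚ (fun _ : ℕ => R) k

theorem coeffT_of (k : ℕ) (f : PowerSeries R) : coeffT k (of f) = PowerSeries.coeff k f := rfl

theorem ext_coeffT {f g : HadamardSeries R} (h : ∀ k, coeffT k f = coeffT k g) : f = g := funext h

/-- A map to a Hadamard algebra is a homomorphism of algebras if all its coefficients are. -/
theorem exists_algHom {A : Type*} [Ring A] [Algebra ℚ A] (Ψ : A →ₗ[ℚ] HadamardSeries R)
    (S : ℕ → A →ₐ[ℚ] R) (h : ∀ k a, coeffT k (Ψ a) = S k a) :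
    ∃ Ψ' : A →ₐ[ℚ] HadamardSeries R, Ψ'.toLinearMap = Ψ :=
  ⟨AlgHom.ofLinearMap Ψ (ext_coeffT fun k => by rw [h, map_one, map_one])
    (fun a b => ext_coeffT fun k => by rw [h, map_mul, map_mul, h, h]), rfl⟩

end HadamardSeries

open HadamardSeries

/-- A homomorphism on `FQSym` whose value at `G_π` only depends on the descent composition of
`π⁻¹` factors through `ρ`. -/
theorem exists_factorization {H : Type*} [CommRing H] [Algebra ℚ H] (Ψ : FQSym →ₐ[ℚ] H)
    (v : ∀ {n : ℕ}, Composition n → H)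
    (h : ∀ (n : ℕ) (π : Equiv.Perm (Fin n)), Ψ (basisG ⟨n, π⟩) = v (Comp π⁻¹)) :
    ∃ φ : QSym →ₐ[ℚ] H, (∀ (n : ℕ) (L : Composition n), φ (F L) = v L) ∧
      Ψ.toLinearMap = φ.toLinearMap ∘ₗ rho := by
  let φ₀ : QSym →ₗ[ℚ] H := basisF.constr ℚ fun L => v L.2
  have hF : ∀ (n : ℕ) (L : Composition n), φ₀ (F L) = v L := fun n L => by
    rw [← basisF_apply ⟨n, L⟩]
    exact Module.Basis.constr_basis _ _ _ _
  have hΨ : Ψ.toLinearMap = φ₀ ∘ₗ rho := basisG.ext fun ⟨n, π⟩ => by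
    rw [LinearMap.comp_apply, rho_basisG, hF]
    exact h n π
  have hΨ' : ∀ f, φ₀ (rhoHom f) = Ψ f := fun f => (LinearMap.congr_fun hΨ f).symm
  refine ⟨AlgHom.ofLinearMap φ₀ ?_ fun f g => ?_, hF, hΨ⟩
  · rw [← map_one rhoHom, hΨ', map_one]
  · obtain ⟨f, rfl⟩ := rhoHom_surjective f
    obtain ⟨g, rfl⟩ := rhoHom_surjective g
    rw [← map_mul, hΨ', hΨ', hΨ', map_mul]

/-- A homomorphism on `QSym` maps onto a shuffle algebra of `st` if its value at `F_L` only depends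
on `|L|` and `st L`, and if these values are independent. -/
theorem isShuffleAlgebraHom_of_linearIndependent {α : Type*}
    (st : ∀ {n : ℕ}, Composition n → α) {H : Type*} [CommRing H] [Algebra ℚ H]
    (φ : QSym →ₐ[ℚ] H) (v : ℕ → α → H)
    (hv : ∀ (n : ℕ) (L : Composition n), φ (F L) = v n (st L))
    (hli : LinearIndependent ℚ fun q : Quotient (stSetoid st) => v q.out.1 (st q.out.2)) :
    IsShuffleAlgebraHom st φ := by
  let w : Quotient (stSetoid st) → φ.range := fun q =>
    ⟨v q.out.1 (st q.out.2), F q.out.2, hv _ _⟩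
  have hout : ∀ (n : ℕ) (L : Composition n),
      v (Quotient.mk (stSetoid st) ⟨n, L⟩).out.1 (st (Quotient.mk (stSetoid st) ⟨n, L⟩).out.2) =
        v n (st L) := by
    intro n L
    have h : ((Quotient.mk (stSetoid st) ⟨n, L⟩).out.1,
        st (Quotient.mk (stSetoid st) ⟨n, L⟩).out.2) = (n, st L) :=
      Quotient.exact (Quotient.out_eq (Quotient.mk (stSetoid st) ⟨n, L⟩))
    exact congrArg (fun p : ℕ × α => v p.1 p.2) h
  have hw : LinearIndependent ℚ w := LinearIndependent.of_comp φ.range.val.toLinearMap hli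
  have hspan : ⊤ ≤ Submodule.span ℚ (Set.range w) := by
    rintro ⟨_, f, rfl⟩ -
    have hf : f ∈ Submodule.span ℚ (Set.range fun L : Σ n, Composition n => F L.2) :=
      span_F ▸ Submodule.mem_top
    have := Submodule.mem_map_of_mem (f := φ.rangeRestrict.toLinearMap) hf
    rw [Submodule.map_span, ← Set.range_comp] at this
    refine Submodule.span_mono ?_ this
    rintro _ ⟨⟨n, L⟩, rfl⟩
    exact ⟨Quotient.mk _ ⟨n, L⟩, Subtype.ext ((hout n L).trans (hv n L).symm)⟩
  refine ⟨Module.Basis.mk hw hspan, fun n L => ?_⟩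
  rw [Module.Basis.mk_apply, hv]
  exact (hout n L).symm

/-- The values of the statistic can be told apart by the order and the leading coefficient of
series in `t`. -/
theorem isShuffleAlgebraHom_of_leading {α R : Type*} [CommRing R] [Algebra ℚ R]
    (st : ∀ {n : ℕ}, Composition n → α) (φ : QSym →ₐ[ℚ] HadamardSeries (PowerSeries R))
    (v : ℕ → α → HadamardSeries (PowerSeries R)) (r : ℕ → α → ℕ) (U : ℕ → α → PowerSeries R)
    (hφ : ∀ (n : ℕ) (L : Composition n), φ (F L) = v n (st L))
    (hv : ∀ n a k, coeffT k (v n a) =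
      PowerSeries.monomial n (PowerSeries.coeff k (PowerSeries.X ^ r n a * U n a)))
    (l : α → R →ₗ[ℚ] ℚ)
    (hl : ∀ (n : ℕ) (L : Composition n), l (st L) (PowerSeries.constantCoeff (U n (st L))) ≠ 0)
    (h0 : ∀ (n : ℕ) (L K : Composition n), st L ≠ st K → r n (st L) = r n (st K) →
      l (st L) (PowerSeries.constantCoeff (U n (st K))) = 0) :
    IsShuffleAlgebraHom st φ := by
  have hlead : ∀ (n : ℕ) (a : α) (k : ℕ), k ≤ r n a →
      PowerSeries.coeff k (PowerSeries.X ^ r n a * U n a) =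
        if k = r n a then PowerSeries.constantCoeff (U n a) else 0 := by
    intro n a k hk
    rw [PowerSeries.coeff_X_pow_mul']
    rcases hk.lt_or_eq with h | h
    · rw [if_neg (not_le.2 h), if_neg h.ne]
    · subst h
      simp
  refine isShuffleAlgebraHom_of_linearIndependent st φ v hφ
    (linearIndependent_of_triangular _ (fun q => r q.out.1 (st q.out.2)) (fun q =>
      l (st q.out.2) ∘ₗ (PowerSeries.coeff (R := R) q.out.1).restrictScalars ℚ ∘ₗ
        (coeffT (r q.out.1 (st q.out.2))).toLinearMap) (fun q => ?_) fun q q' hne hle => ?_)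
  · have := hl q.out.1 q.out.2
    simpa [hv, hlead] using this
  · have hne' : (q'.out.1, st q'.out.2) ≠ (q.out.1, st q.out.2) := fun h => hne (by
      rw [← q.out_eq, ← q'.out_eq]
      exact Quotient.sound h)
    generalize q.out = L at *
    generalize q'.out = K at *
    obtain ⟨n, L⟩ := L
    obtain ⟨m, K⟩ := K
    simp only [LinearMap.comp_apply, AlgHom.toLinearMap_apply, LinearMap.restrictScalars_apply,
      hv, PowerSeries.coeff_monomial]
    split_ifs with h
    · subst h
      rw [hlead _ _ _ hle]
      split_ifs with h
      · exact h0 _ L K (fun e => hne' (by simp only [e])) h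
      · exact map_zero _
    · exact map_zero _

/-! ### The three power series as generating functions -/

/-- Series in `t` over `K` define elements of `K[[t*, x]]`, concentrated in a single degree. -/
theorem coeffT_of_mul_recip {K : Type*} [CommRing K] [Algebra ℚ K] (P Q : PowerSeries K)
    (hQ : PowerSeries.constantCoeff Q = 1) (n k : ℕ) :
    coeffT k (of (PowerSeries.map PowerSeries.C P * recip (PowerSeries.map PowerSeries.C Q) *
      xVar ^ n)) =
      PowerSeries.monomial n (PowerSeries.coeff k (P * PowerSeries.invOfUnit Q 1)) := by
  have h1 : recip (PowerSeries.map PowerSeries.C Q) =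
      PowerSeries.map PowerSeries.C (PowerSeries.invOfUnit Q 1) := by
    have h2 := mul_recip (PowerSeries.map PowerSeries.C Q) (by
      rw [← PowerSeries.coeff_zero_eq_constantCoeff_apply, PowerSeries.coeff_map,
        PowerSeries.coeff_zero_eq_constantCoeff_apply, hQ, map_one])
    have h3 : Q * PowerSeries.invOfUnit Q 1 = 1 := PowerSeries.mul_invOfUnit Q 1 (by simpa using hQ)
    have h4 := congrArg (PowerSeries.map (PowerSeries.C (R := K))) h3
    rw [map_mul, map_one] at h4
    linear_combination (PowerSeries.map PowerSeries.C (PowerSeries.invOfUnit Q 1)) * h2 -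
      recip (PowerSeries.map PowerSeries.C Q) * h4
  rw [h1, ← map_mul, coeffT_of, ← map_pow, PowerSeries.coeff_mul_C, PowerSeries.coeff_map]
  ext j
  rw [PowerSeries.coeff_C_mul, PowerSeries.coeff_X_pow, PowerSeries.coeff_monomial, mul_ite,
    mul_one, mul_zero]

theorem eq_mul_invOfUnit {K : Type*} [CommRing K] {A P Q : PowerSeries K}
    (hQ : PowerSeries.constantCoeff Q = 1) (h : Q * A = P) :
    A = P * PowerSeries.invOfUnit Q 1 := by
  have h3 : Q * PowerSeries.invOfUnit Q 1 = 1 := PowerSeries.mul_invOfUnit Q 1 (by simpa using hQ)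
  rw [← h]
  linear_combination (-A) * h3

open PowerSeries in
/-- The quotient of `desComajSeries n d c` by its leading power of `t`. -/
def desComajUnit (n : ℕ) (a : ℕ × ℕ) : PowerSeries (PowerSeries ℚ) :=
  if n = 0 then invOfUnit (1 - X) 1
  else C X ^ a.2 * invOfUnit (∏ i ∈ range (n + 1), (1 - X * C X ^ i)) 1

open PowerSeries in
theorem coeffT_desComajSeries (n k : ℕ) (a : ℕ × ℕ) : coeffT k (desComajSeries n a.1 a.2) =
    monomial n (coeff k (X ^ (if n = 0 then 0 else a.1 + 1) * desComajUnit n a)) := by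
  rw [desComajSeries, desComajUnit]
  split_ifs with h
  · subst h
    rw [pow_zero, ← coeffT_of_mul_recip 1 (1 - X) (by simp)]
    simp
  · rw [← mul_assoc, ← coeffT_of_mul_recip _ _ (by simp [map_prod])]
    simp [map_prod]

open PowerSeries in
/-- The quotient of `pkSeries n p` by its leading power of `t`. -/
def pkUnit (n p : ℕ) : PowerSeries ℚ :=
  if n = 0 then invOfUnit (1 - X) 1
  else 2 ^ (2 * p + 1) * (1 + X) ^ (n - 2 * p - 1) * invOfUnit ((1 - X) ^ (n + 1)) 1

open PowerSeries in
theorem coeffT_pkSeries (n k p : ℕ) : coeffT k (pkSeries n p) =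
    monomial n (coeff k (X ^ (if n = 0 then 0 else p + 1) * pkUnit n p)) := by
  rw [pkSeries, pkUnit]
  split_ifs with h
  · subst h
    rw [pow_zero, ← coeffT_of_mul_recip 1 (1 - X) (by simp)]
    simp
  · have hP : PowerSeries.map PowerSeries.C (X ^ (p + 1) *
        (2 ^ (2 * p + 1) * (1 + X) ^ (n - 2 * p - 1)) : PowerSeries ℚ) =
          2 ^ (2 * p + 1) * tVar ^ (p + 1) * (1 + tVar) ^ (n - 2 * p - 1) := by
      simp only [map_mul, map_pow, map_add, map_one, map_X, map_ofNat]
      ring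
    have hQ : PowerSeries.map PowerSeries.C ((1 - X) ^ (n + 1) : PowerSeries ℚ) =
        (1 - tVar) ^ (n + 1) := by
      simp only [map_pow, map_sub, map_one, map_X]
    rw [← mul_assoc, ← coeffT_of_mul_recip _ _ (by simp), hP, hQ]

open PowerSeries in
/-- The quotient of `lpkSeries n p` by its leading power of `t`. -/
def lpkUnit (n p : ℕ) : PowerSeries ℚ :=
  2 ^ (2 * p) * (1 + X) ^ (n - 2 * p) * invOfUnit ((1 - X) ^ (n + 1)) 1

open PowerSeries in
theorem coeffT_lpkSeries (n k p : ℕ) : coeffT k (lpkSeries n p) =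
    monomial n (coeff k (X ^ p * lpkUnit n p)) := by
  have hP : PowerSeries.map PowerSeries.C (X ^ p *
      (2 ^ (2 * p) * (1 + X) ^ (n - 2 * p)) : PowerSeries ℚ) =
        2 ^ (2 * p) * tVar ^ p * (1 + tVar) ^ (n - 2 * p) := by
    simp only [map_mul, map_pow, map_add, map_one, map_X, map_ofNat]
    ring
  have hQ : PowerSeries.map PowerSeries.C ((1 - X) ^ (n + 1) : PowerSeries ℚ) =
      (1 - tVar) ^ (n + 1) := by
    simp only [map_pow, map_sub, map_one, map_X]
  rw [lpkSeries, lpkUnit, ← mul_assoc, ← coeffT_of_mul_recip _ _ (by simp), hP, hQ]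

open PowerSeries in
theorem coeff_recip_one_sub_X {K : Type*} [CommRing K] (k : ℕ) :
    coeff k (invOfUnit (1 - X : PowerSeries K) 1) = 1 := by
  have h := eq_mul_invOfUnit (A := PowerSeries.mk 1) (P := 1) (Q := (1 - X : PowerSeries K))
    (by simp) (by rw [mul_comm]; exact mk_one_mul_one_sub_eq_one K)
  rw [one_mul] at h
  rw [← h]
  simp

/-- The coefficient of `t ^ k` enumerates sequences in `k` positive letters. -/
theorem coeffT_desComajSeries_eq_enum (k n : ℕ) (L : Composition n) :
    coeffT k (desComajSeries n (cdes L) (ccomaj L)) =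
      PowerSeries.monomial n (enum qWeight k (fun _ => True) (cDes L) n) := by
  refine (coeffT_desComajSeries n k (cdes L, ccomaj L)).trans ?_
  rw [desComajUnit]
  cases n with
  | zero => rw [if_pos rfl, if_pos rfl, pow_zero, one_mul, coeff_recip_one_sub_X, enum_zero]
  | succ n =>
    have hD : {i ∈ range (n + 1) | i ∈ cDes L} = cDes L := by
      ext i
      have := @cDes_subset _ L i
      simp only [mem_filter, mem_range]
      exact ⟨fun h => h.2, fun h => ⟨(this h).2, h⟩⟩
    have h := qEnumSeries_mul (D := cDes L) (fun h => (cDes_subset L h).1.false) (n + 1)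
    rw [hD, mul_comm] at h
    rw [if_neg n.succ_ne_zero, if_neg n.succ_ne_zero, pow_succ', mul_assoc, ← mul_assoc (_ ^ _)]
    simp only [cdes, ccomaj]
    rw [← eq_mul_invOfUnit (by simp [map_prod]) h]
    cases k with
    | zero => simp [enum_zero_letters]
    | succ k => rw [PowerSeries.coeff_succ_X_mul, qEnumSeries, PowerSeries.coeff_mk]

/-- The coefficient of `t ^ k` enumerates sequences in `2 * k` letters with alternating signs, the
smallest one being negative. -/
theorem coeffT_pkSeries_eq_enum (k n : ℕ) (L : Composition n) :
    coeffT k (pkSeries n (cpk L)) =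
      PowerSeries.monomial n (enum (fun _ => (1 : ℚ)) (2 * k) Odd (cDes L) n) := by
  rw [coeffT_pkSeries, pkUnit]
  cases n with
  | zero => rw [if_pos rfl, if_pos rfl, pow_zero, one_mul, coeff_recip_one_sub_X, enum_zero]
  | succ n =>
    -- For the first letter the condition on repetitions is void. Counting the position `0` as a
    -- descent, the peaks are the descents after a position that is not one.
    have hp : numUp (fun i => i = 0 ∨ i ∈ cDes L) (n + 1) = cpk L := by
      rw [numUp, cpk]
      congr 1
      ext i
      have := @cDes_subset _ L i
      simp only [mem_filter, mem_range, not_or]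
      constructor
      · rintro ⟨-, h1, h2 | h2, h3, h4⟩
        · omega
        · exact ⟨h2, by omega, h4⟩
      · rintro ⟨h1, h2, h3⟩
        exact ⟨(this h1).2, by omega, Or.inr h1, by omega, h3⟩
    have h := (alternating_series (T := fun i => i = 0 ∨ i ∈ cDes L)
      (N := fun n m => enum (fun _ => (1 : ℚ)) m Odd (cDes L) n) (Or.inl rfl)
      (fun m => enum_zero _ _ _ _) (fun n => enum_zero_letters _ _ _ _) (fun n m => by
        cases n with
        | zero => simp only [enum_succ, enum_zero, one_mul]
        | succ n =>
          rw [enum_succ, one_mul]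
          have : (Odd m ↔ n + 1 ∉ cDes L) ↔ (Even m ↔ n + 1 = 0 ∨ n + 1 ∈ cDes L) := by
            rw [← Nat.not_even_iff_odd]
            simp only [n.succ_ne_zero, false_or]
            tauto
          simp only [this]) n).1
    rw [hp] at h
    rw [if_neg n.succ_ne_zero, if_neg n.succ_ne_zero, ← mul_assoc, ← mul_assoc,
      mul_comm (_ ^ _) (2 ^ _), ← eq_mul_invOfUnit (by simp) h, PowerSeries.coeff_mk]

/-- The coefficient of `t ^ k` enumerates sequences in `2 * k + 1` letters with alternating signs,
the smallest one being positive. -/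
theorem coeffT_lpkSeries_eq_enum (k n : ℕ) (L : Composition n) :
    coeffT k (lpkSeries n (clpk L)) =
      PowerSeries.monomial n (enum (fun _ => (1 : ℚ)) (2 * k + 1) Even (cDes L) n) := by
  rw [coeffT_lpkSeries, lpkUnit]
  have h0 : 0 ∉ cDes L := fun h => (cDes_subset L h).1.false
  cases n with
  | zero =>
    have : clpk L = 0 := by
      rw [clpk, card_eq_zero, filter_eq_empty_iff]
      intro i hi
      have := cDes_subset L hi
      omega
    rw [this, enum_zero, Nat.zero_sub, mul_zero, pow_zero, pow_zero, pow_zero, zero_add, pow_one,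
      one_mul, one_mul, one_mul, coeff_recip_one_sub_X]
  | succ n =>
    have hp : numDown (fun i => i ∉ cDes L) (n + 1) = clpk L := by
      rw [numDown, clpk]
      congr 1
      ext i
      have := @cDes_subset _ L i
      simp only [mem_filter, mem_range, not_not]
      exact ⟨fun h => h.2.2, fun h => ⟨(this h.1).2, (this h.1).1, h⟩⟩
    have h := (alternating_series (T := fun i => i ∉ cDes L)
      (N := fun n m => enum (fun _ => (1 : ℚ)) m Even (cDes L) n) h0
      (fun m => enum_zero _ _ _ _) (fun n => enum_zero_letters _ _ _ _)
      (fun n m => by rw [enum_succ, one_mul]) n).2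
    rw [hp] at h
    rw [← mul_assoc, ← mul_assoc,
      mul_comm (_ ^ _) (2 ^ _), ← eq_mul_invOfUnit (by simp) h, PowerSeries.coeff_mk]

/-! ### The homomorphisms -/

/-- If the coefficients of `t ^ k` in the values of `Ψ` enumerate sequences over suitable alphabets,
then `Ψ` is a homomorphism that factors through `ρ`. -/
theorem exists_hom_of_enum {α R : Type*} [CommRing R] [Algebra ℚ R]
    (Ψ : FQSym →ₗ[ℚ] HadamardSeries (PowerSeries R)) (st : ∀ {n : ℕ}, Composition n → α)
    (v : ℕ → α → HadamardSeries (PowerSeries R))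
    (hΨ : ∀ (n : ℕ) (π : Equiv.Perm (Fin n)), Ψ (basisG ⟨n, π⟩) = v n (st (Comp π⁻¹)))
    (wt : ℕ → R) (m : ℕ → ℕ) (s : ℕ → Prop) [DecidablePred s]
    (henum : ∀ (k n : ℕ) (L : Composition n), coeffT k (v n (st L)) =
      PowerSeries.monomial n (enum wt (m k) s (cDes L) n)) :
    (∃ Ψ' : FQSym →ₐ[ℚ] HadamardSeries (PowerSeries R), Ψ'.toLinearMap = Ψ) ∧
      ∃ φ : QSym →ₐ[ℚ] HadamardSeries (PowerSeries R),
        (∀ (n : ℕ) (L : Composition n), φ (F L) = v n (st L)) ∧ Ψ = φ.toLinearMap ∘ₗ rho := by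
  have hspec : ∀ k f, coeffT k (Ψ f) = spec wt (m k) s f := by
    intro k f
    have : (coeffT k).toLinearMap ∘ₗ Ψ = (spec wt (m k) s).toLinearMap :=
      basisG.ext fun ⟨n, π⟩ => by
        change coeffT k (Ψ _) = spec wt (m k) s _
        rw [hΨ, henum, spec_basisG, cDes_Comp]
    exact LinearMap.congr_fun this f
  obtain ⟨Ψ', hΨ'⟩ := exists_algHom Ψ _ hspec
  obtain ⟨φ, hφ, hfac⟩ := exists_factorization Ψ' (fun {n} L => v n (st L)) fun n π => by
    rw [← hΨ, ← hΨ']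
    rfl
  exact ⟨⟨Ψ', hΨ'⟩, φ, hφ, hΨ' ▸ hfac⟩

theorem PsiIdesIcomaj_basisG (n : ℕ) (π : Equiv.Perm (Fin n)) :
    PsiIdesIcomaj (basisG ⟨n, π⟩) = desComajSeries n (ides π) (icomaj π) :=
  Module.Basis.constr_basis _ _ _ _

theorem PsiIpk_basisG (n : ℕ) (π : Equiv.Perm (Fin n)) :
    PsiIpk (basisG ⟨n, π⟩) = pkSeries n (ipk π) :=
  Module.Basis.constr_basis _ _ _ _

theorem PsiIlpk_basisG (n : ℕ) (π : Equiv.Perm (Fin n)) :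
    PsiIlpk (basisG ⟨n, π⟩) = lpkSeries n (ilpk π) :=
  Module.Basis.constr_basis _ _ _ _

theorem composition_zero_eq (L K : Composition 0) : L = K := by
  refine cDes_injective ?_
  ext i
  have hL := @cDes_subset _ L i
  have hK := @cDes_subset _ K i
  exact ⟨fun h => absurd (hL h).2 (Nat.not_lt_zero i), fun h => absurd (hK h).2 (Nat.not_lt_zero i)⟩

theorem constantCoeff_two : PowerSeries.constantCoeff (2 : PowerSeries ℚ) = 2 := map_ofNat _ 2

theorem isShuffleAlgebraHom_desComaj (φ : QSym →ₐ[ℚ] Htqx)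
    (hφ : ∀ (n : ℕ) (L : Composition n), φ (F L) = desComajSeries n (cdes L) (ccomaj L)) :
    IsShuffleAlgebraHom (fun L => (cdes L, ccomaj L)) φ := by
  have hU : ∀ n, n ≠ 0 → ∀ a, PowerSeries.constantCoeff (desComajUnit n a) =
      PowerSeries.X ^ a.2 := fun n hn a => by
    simp [desComajUnit, hn]
  refine isShuffleAlgebraHom_of_leading _ φ (fun n a => desComajSeries n a.1 a.2)
    (fun n a => if n = 0 then 0 else a.1 + 1) desComajUnit hφ
    (fun n a k => coeffT_desComajSeries n k a) (fun a => PowerSeries.coeff a.2)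
    (fun n L => ?_) fun n L K hne hr => ?_
  · rcases eq_or_ne n 0 with rfl | hn
    · have : ccomaj L = 0 := sum_eq_zero fun i hi => by
        have := cDes_subset L hi
        omega
      simp [desComajUnit, this]
    · simp [hU n hn]
  · rcases eq_or_ne n 0 with rfl | hn
    · exact absurd (by rw [composition_zero_eq L K]) hne
    · rw [hU n hn, PowerSeries.coeff_X_pow, if_neg]
      intro hc
      simp only [hn, if_false, add_left_inj] at hr
      exact hne (Prod.ext hr hc)

theorem isShuffleAlgebraHom_pk (φ : QSym →ₐ[ℚ] Htx)
    (hφ : ∀ (n : ℕ) (L : Composition n), φ (F L) = pkSeries n (cpk L)) :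
    IsShuffleAlgebraHom (fun L => cpk L) φ := by
  refine isShuffleAlgebraHom_of_leading _ φ pkSeries (fun n p => if n = 0 then 0 else p + 1)
    pkUnit hφ (fun n a k => coeffT_pkSeries n k a) (fun _ => LinearMap.id)
    (fun n L => ?_) fun n L K hne hr => ?_
  · rw [pkUnit]
    split_ifs <;> simp [constantCoeff_two]
  · rcases eq_or_ne n 0 with rfl | hn
    · exact absurd (by rw [composition_zero_eq L K]) hne
    · simp only [hn, if_false, add_left_inj] at hr
      exact absurd hr hne

theorem isShuffleAlgebraHom_lpk (φ : QSym →ₐ[ℚ] Htx)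
    (hφ : ∀ (n : ℕ) (L : Composition n), φ (F L) = lpkSeries n (clpk L)) :
    IsShuffleAlgebraHom (fun L => clpk L) φ :=
  isShuffleAlgebraHom_of_leading _ φ lpkSeries (fun _ p => p)
    lpkUnit hφ (fun n a k => coeffT_lpkSeries n k a) (fun _ => LinearMap.id)
    (fun n L => by simp [lpkUnit, constantCoeff_two]) fun n L K hne hr => absurd hr hne

end FreeQSym

end

theorem mainTheorem2 :
    -- the canonical map `ρ` is a surjective algebra homomorphism
    (∃ r : FQSym →ₐ[ℚ] QSym, r.toLinearMap = rho ∧ Function.Surjective r ∧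
      ∀ (n : ℕ) (π : Equiv.Perm (Fin n)), r (basisG ⟨n, π⟩) = F (Comp π⁻¹)) ∧
    -- the map for `(ides, icomaj)`
    ((∃ Ψ : FQSym →ₐ[ℚ] Htqx, Ψ.toLinearMap = PsiIdesIcomaj ∧
        ∀ (n : ℕ) (π : Equiv.Perm (Fin n)),
          Ψ (basisG ⟨n, π⟩) = desComajSeries n (ides π) (icomaj π)) ∧
      ∃ φ : QSym →ₐ[ℚ] Htqx, IsShuffleAlgebraHom (fun L => (cdes L, ccomaj L)) φ ∧
        (∀ (n : ℕ) (L : Composition n), φ (F L) = desComajSeries n (cdes L) (ccomaj L)) ∧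
        PsiIdesIcomaj = φ.toLinearMap ∘ₗ rho) ∧
    -- the map for `ipk`
    ((∃ Ψ : FQSym →ₐ[ℚ] Htx, Ψ.toLinearMap = PsiIpk ∧
        ∀ (n : ℕ) (π : Equiv.Perm (Fin n)), Ψ (basisG ⟨n, π⟩) = pkSeries n (ipk π)) ∧
      ∃ φ : QSym →ₐ[ℚ] Htx, IsShuffleAlgebraHom (fun L => cpk L) φ ∧
        (∀ (n : ℕ) (L : Composition n), φ (F L) = pkSeries n (cpk L)) ∧
        PsiIpk = φ.toLinearMap ∘ₗ rho) ∧
    -- the map for `ilpk`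
    ((∃ Ψ : FQSym →ₐ[ℚ] Htx, Ψ.toLinearMap = PsiIlpk ∧
        ∀ (n : ℕ) (π : Equiv.Perm (Fin n)), Ψ (basisG ⟨n, π⟩) = lpkSeries n (ilpk π)) ∧
      ∃ φ : QSym →ₐ[ℚ] Htx, IsShuffleAlgebraHom (fun L => clpk L) φ ∧
        (∀ (n : ℕ) (L : Composition n), φ (F L) = lpkSeries n (clpk L)) ∧
        PsiIlpk = φ.toLinearMap ∘ₗ rho) := by
  refine ⟨⟨rhoHom, rfl, rhoHom_surjective, fun n π => rhoHom_basisG π⟩, ?_, ?_, ?_⟩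
  · obtain ⟨⟨Ψ, hΨ⟩, φ, hφ, hfac⟩ := exists_hom_of_enum PsiIdesIcomaj
      (fun L => (cdes L, ccomaj L)) (fun n a => desComajSeries n a.1 a.2)
      (fun n π => by rw [PsiIdesIcomaj_basisG, ides, icomaj, des_eq, comaj_eq])
      qWeight (fun k => k) (fun _ => True) coeffT_desComajSeries_eq_enum
    refine ⟨⟨Ψ, hΨ, fun n π => ?_⟩, φ, isShuffleAlgebraHom_desComaj φ hφ, hφ, hfac⟩
    rw [← PsiIdesIcomaj_basisG, ← hΨ]
    rfl
  · obtain ⟨⟨Ψ, hΨ⟩, φ, hφ, hfac⟩ := exists_hom_of_enum PsiIpk (fun L => cpk L) pkSeries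
      (fun n π => by rw [PsiIpk_basisG, ipk, pk_eq])
      (fun _ => 1) (fun k => 2 * k) Odd coeffT_pkSeries_eq_enum
    refine ⟨⟨Ψ, hΨ, fun n π => ?_⟩, φ, isShuffleAlgebraHom_pk φ hφ, hφ, hfac⟩
    rw [← PsiIpk_basisG, ← hΨ]
    rfl
  · obtain ⟨⟨Ψ, hΨ⟩, φ, hφ, hfac⟩ := exists_hom_of_enum PsiIlpk (fun L => clpk L) lpkSeries
      (fun n π => by rw [PsiIlpk_basisG, ilpk, lpk_eq])
      (fun _ => 1) (fun k => 2 * k + 1) Even coeffT_lpkSeries_eq_enum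
    refine ⟨⟨Ψ, hΨ, fun n π => ?_⟩, φ, isShuffleAlgebraHom_lpk φ hφ, hφ, hfac⟩
    rw [← PsiIlpk_basisG, ← hΨ]
    rfl
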